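/- Let $k$ be a field. A finite tensor category over $k$ is a $k$-linear abelian rigid monoidal category with finite-dimensional spaces of morphisms and $k$-bilinear tensor product, in which every object has finite length and the unit object $\mathbf 1$ is simple, and which is equivalent, as a $k$-linear category, to the category of finite-dimensional modules over a finite-dimensional $k$-algebra. For each object $X$ fix a dual object $(X^*,\ \mathrm{ev}_X: X^*\otimes X\to\mathbf 1,\ \mathrm{coev}_X:\mathbf 1\to X\otimes X^*)$. Pivotal cover. For such a rigid monoidal category $\mathcal C$, let $\mathcal C^{\mathrm{piv}}$ be the category of pairs $\mathbf V=(V,\phi)$ with $\phi:V\to V^{**}$ an isomorphism; a morphism $(V,\phi)\to(W,\psi)$ is a morphism $f:V\to W$ with $\psi f=f^{**}\phi$. Let $\mathbf 1=(\mathbf 1,\delta_0)$, where $\delta_0:\mathbf 1\to\mathbf 1^{**}$ is the unit constraint of the monoidal functor $(-)^{**}$, and let $\mathbf V^*=(V^*,(\phi^*)^{-1})$. A strong monoidal functor $F$ induces $F^{\mathrm{piv}}(V,\phi)=(F(V),\xi^F_V\circ F(\phi))$, where $\xi^F_V: F(V^{**})\to F(V^*)^*\to F(V)^{**}$ is the canonical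 isomorphism. Indicators. For $n\ge1$ put $V^{\otimes n}=V\otimes(V\otimes(\cdots\otimes V))$ and let $E^{(n)}_{\mathbf V}$ be the linear automorphism of $\mathrm{Hom}(\mathbf 1,V^{\otimes n})$ which, for $n\ge 2$, is the composite $$\mathrm{Hom}(\mathbf 1,V\otimes V^{\otimes(n-1)})\cong\mathrm{Hom}(V^*,V^{\otimes(n-1)})\cong\mathrm{Hom}(\mathbf 1,V^{\otimes(n-1)}\otimes V^{**})\xrightarrow{(\mathrm{id}\otimes\phi^{-1})\circ-}\mathrm{Hom}(\mathbf 1,V^{\otimes(n-1)}\otimes V)\cong\mathrm{Hom}(\mathbf 1,V^{\otimes n}),$$ the last isomorphism being given by the associativity constraint, and which for $n=1$ is $f\mapsto\phi^{-1}\circ f^{**}\circ\delta_0$. Let $E^{(0)}_{\mathbf V}$ be the endomorphism $f\mapsto\mathrm{ev}_V\circ(\mathrm{id}\otimes\phi^{-1})\circ\mathrm{coev}_{V^*}\circ f$ of $\mathrm{End}(\mathbf 1)$. Set $\nu_{n,r}(\mathbf V)=\mathrm{Tr}\big((E^{(n)}_{\mathbf V})^r\big)$ for $n>0$, $r\in\mathbb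 Z$ and for $n=0$, $r\ge0$, and $\nu_{n,r}(\mathbf V)=\nu_{-n,-r}(\mathbf V^*)$ for the remaining integers $n,r$. Adjoint object. Let $\mathcal Z(\mathcal C)$ be the monoidal (Drinfeld) center of $\mathcal C$, with dual objects having the same evaluation and coevaluation as in $\mathcal C$, and $U:\mathcal Z(\mathcal C)\to\mathcal C$ the forgetful functor. Theorem. Let $\mathcal C$ and $\mathcal D$ be finite tensor categories over $k$, and suppose that there is an equivalence $F:\mathcal C\to\mathcal D$ of $k$-linear monoidal categories. Then the functors $U^{\mathrm{piv}}:\mathcal Z(\mathcal C)^{\mathrm{piv}}\to\mathcal C^{\mathrm{piv}}$ and $U^{\mathrm{piv}}:\mathcal Z(\mathcal D)^{\mathrm{piv}}\to\mathcal D^{\mathrm{piv}}$ have right adjoints. For every choice of right adjoints $I_r^{\mathrm{piv}}$, the adjoint objects $\mathbf A_{\mathcal C}=U^{\mathrm{piv}}I_r^{\mathrm{piv}}(\mathbf 1)\in\mathcal C^{\mathrm{piv}}$ and $\mathbf A_{\mathcal D}=U^{\mathrm{piv}}I_r^{\mathrm{piv}}(\mathbf 1)\in\mathcal D^{\mathrm{piv}}$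 satisfy $$\nu_{n,r}(\mathbf A_{\mathcal C})=\nu_{n,r}(\mathbf A_{\mathcal D})\qquad\text{for all integers } n \text{ and } r.$$ -/

import Mathlib

open CategoryTheory MonoidalCategory
noncomputable section
namespace FSIndicator
section CenterDual
universe v u
variable {C : Type u} [Category.{v} C] [MonoidalCategory C]

theorem evaluation_cancel {X Y Z : C} (p : ExactPairing X Y) {a b : Z ⟶ Y}
    (h : a ▷ X ≫ p.evaluation' = b ▷ X ≫ p.evaluation') : a = b := by
  let _ : HasRightDual X := @HasRightDual.mk C _ _ X Y p
  have h1 := congrArg (tensorRightHomEquiv Z X Xᘁ (𝟙_ C)) h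
  have h2 := tensorRightHomEquiv_whiskerRight_comp_evaluation (X := X) a
  have h3 := tensorRightHomEquiv_whiskerRight_comp_evaluation (X := X) b
  exact (cancel_mono (λ_ Y).inv).1 (h2.symm.trans (h1.trans h3))

/-- For an object `X` with half-braiding `b` and a dual object `Y` of `X`, the half-braiding
`Y ⊗ U ⟶ Y ⊗ U ⊗ X ⊗ Y ⟶ Y ⊗ X ⊗ U ⊗ Y ⟶ U ⊗ Y` of `Y`, given by `coev`, `b_U⁻¹` and `ev`. -/
def dualBraidingHom {X : C} (b : HalfBraiding X) (Y : C) [ExactPairing X Y] (U : C) :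
    Y ⊗ U ⟶ U ⊗ Y :=
  𝟙 _ ⊗≫ (Y ⊗ U) ◁ η_ X Y ⊗≫ Y ◁ (b.β U).inv ▷ Y ⊗≫ ε_ X Y ▷ (U ⊗ Y) ⊗≫ 𝟙 _

theorem halfBraiding_inv_naturality {X : C} (b : HalfBraiding X) {U V : C} (f : U ⟶ V) :
    f ▷ X ≫ (b.β V).inv = (b.β U).inv ≫ X ◁ f := by
  rw [Iso.comp_inv_eq, Category.assoc, b.naturality, Iso.inv_hom_id_assoc]

theorem halfBraiding_inv_tensor {X : C} (b : HalfBraiding X) (U V : C) :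
    (b.β (U ⊗ V)).inv = (α_ _ _ _).hom ≫ U ◁ (b.β V).inv ≫ (α_ _ _ _).inv ≫
      (b.β U).inv ▷ V ≫ (α_ _ _ _).hom := by
  rw [← cancel_epi (b.β (U ⊗ V)).hom, Iso.hom_inv_id, b.monoidal]
  symm
  calc
    _ = 𝟙 _ ⊗≫ (b.β U).hom ▷ V ⊗≫ U ◁ ((b.β V).hom ≫ (b.β V).inv) ⊗≫
        (b.β U).inv ▷ V ⊗≫ 𝟙 _ := by monoidal
    _ = 𝟙 _ ⊗≫ ((b.β U).hom ≫ (b.β U).inv) ▷ V ⊗≫ 𝟙 _ := by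
      rw [Iso.hom_inv_id]; monoidal
    _ = _ := by rw [Iso.hom_inv_id]; monoidal

theorem dualBraidingHom_naturality {X : C} (b : HalfBraiding X) (Y : C) [ExactPairing X Y]
    {U V : C} (f : U ⟶ V) :
    Y ◁ f ≫ dualBraidingHom b Y V = dualBraidingHom b Y U ≫ f ▷ Y := by
  dsimp only [dualBraidingHom]
  calc
    _ = 𝟙 _ ⊗≫ Y ◁ (f ▷ (𝟙_ C) ≫ V ◁ η_ X Y) ⊗≫ Y ◁ (b.β V).inv ▷ Y ⊗≫
        ε_ X Y ▷ (V ⊗ Y) ⊗≫ 𝟙 _ := by monoidal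
    _ = 𝟙 _ ⊗≫ (Y ⊗ U) ◁ η_ X Y ⊗≫ Y ◁ (f ▷ X ≫ (b.β V).inv) ▷ Y ⊗≫
        ε_ X Y ▷ (V ⊗ Y) ⊗≫ 𝟙 _ := by rw [← whisker_exchange]; monoidal
    _ = 𝟙 _ ⊗≫ (Y ⊗ U) ◁ η_ X Y ⊗≫ Y ◁ (b.β U).inv ▷ Y ⊗≫
        ((Y ⊗ X) ◁ f ≫ ε_ X Y ▷ V) ▷ Y ⊗≫ 𝟙 _ := by
      rw [halfBraiding_inv_naturality]; monoidal
    _ = _ := by rw [whisker_exchange]; monoidal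

theorem dualBraidingHom_evaluation {X : C} (b : HalfBraiding X) (Y : C) [ExactPairing X Y]
    (U : C) :
    dualBraidingHom b Y U ▷ X ⊗≫ U ◁ ε_ X Y =
      𝟙 _ ⊗≫ Y ◁ (b.β U).inv ⊗≫ ε_ X Y ▷ U ⊗≫ 𝟙 _ := by
  dsimp only [dualBraidingHom]
  calc
    _ = 𝟙 _ ⊗≫ (Y ⊗ U) ◁ η_ X Y ▷ X ⊗≫ Y ◁ (b.β U).inv ▷ Y ▷ X ⊗≫
        (ε_ X Y ▷ (U ⊗ (Y ⊗ X)) ≫ (𝟙_ C) ◁ (U ◁ ε_ X Y)) ⊗≫ 𝟙 _ := by monoidal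
    _ = 𝟙 _ ⊗≫ (Y ⊗ U) ◁ η_ X Y ▷ X ⊗≫
        Y ◁ ((b.β U).inv ▷ (Y ⊗ X) ≫ (X ⊗ U) ◁ ε_ X Y) ⊗≫ ε_ X Y ▷ U ⊗≫ 𝟙 _ := by
      rw [← whisker_exchange]; monoidal
    _ = 𝟙 _ ⊗≫ (Y ⊗ U) ◁ (η_ X Y ▷ X ⊗≫ X ◁ ε_ X Y) ⊗≫ Y ◁ (b.β U).inv ⊗≫
        ε_ X Y ▷ U ⊗≫ 𝟙 _ := by
      rw [← whisker_exchange]; monoidal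
    _ = _ := by rw [ExactPairing.evaluation_coevaluation'']; monoidal

theorem dualBraidingHom_coevaluation {X : C} (b : HalfBraiding X) (Y : C) [ExactPairing X Y]
    (U : C) :
    𝟙 (𝟙_ C ⊗ U) ⊗≫ η_ X Y ▷ U ⊗≫ X ◁ dualBraidingHom b Y U =
      𝟙 _ ⊗≫ U ◁ η_ X Y ⊗≫ (b.β U).inv ▷ Y ⊗≫ 𝟙 _ := by
  dsimp only [dualBraidingHom]
  calc
    _ = 𝟙 _ ⊗≫ (η_ X Y ▷ (U ⊗ 𝟙_ C) ≫ (X ⊗ Y) ◁ (U ◁ η_ X Y)) ⊗≫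
        X ◁ (Y ◁ (b.β U).inv ▷ Y) ⊗≫ X ◁ ε_ X Y ▷ (U ⊗ Y) ⊗≫ 𝟙 _ := by monoidal
    _ = 𝟙 _ ⊗≫ U ◁ η_ X Y ⊗≫ (η_ X Y ▷ (U ⊗ X) ≫ (X ⊗ Y) ◁ (b.β U).inv) ▷ Y ⊗≫
        X ◁ ε_ X Y ▷ (U ⊗ Y) ⊗≫ 𝟙 _ := by
      rw [← whisker_exchange]; monoidal
    _ = 𝟙 _ ⊗≫ U ◁ η_ X Y ⊗≫ (b.β U).inv ▷ Y ⊗≫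
        (η_ X Y ▷ X ⊗≫ X ◁ ε_ X Y) ▷ (U ⊗ Y) ⊗≫ 𝟙 _ := by
      rw [← whisker_exchange]; monoidal
    _ = _ := by rw [ExactPairing.evaluation_coevaluation'']; monoidal

theorem dualBraidingHom_tensor {X : C} (b : HalfBraiding X) (Y : C) [ExactPairing X Y]
    (U V : C) :
    dualBraidingHom b Y (U ⊗ V) = (α_ _ _ _).inv ≫ (dualBraidingHom b Y U ▷ V) ≫
      (α_ _ _ _).hom ≫ (U ◁ dualBraidingHom b Y V) ≫ (α_ _ _ _).inv := by
  symm
  calc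
    _ = 𝟙 _ ⊗≫ (dualBraidingHom b Y U ▷ V ≫ (U ⊗ Y) ◁
          (𝟙 V ⊗≫ V ◁ η_ X Y ⊗≫ (b.β V).inv ▷ Y ⊗≫ 𝟙 (X ⊗ (V ⊗ Y)))) ⊗≫
          U ◁ ε_ X Y ▷ (V ⊗ Y) ⊗≫ 𝟙 _ := by
      conv_lhs => rw [dualBraidingHom.eq_def b Y V]
      monoidal
    _ = 𝟙 _ ⊗≫ (Y ⊗ U) ◁ (𝟙 V ⊗≫ V ◁ η_ X Y ⊗≫ (b.β V).inv ▷ Y ⊗≫ 𝟙 (X ⊗ (V ⊗ Y))) ⊗≫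
          (dualBraidingHom b Y U ▷ X ⊗≫ U ◁ ε_ X Y) ▷ (V ⊗ Y) ⊗≫ 𝟙 _ := by
      rw [← whisker_exchange]; monoidal
    _ = _ := by
      rw [dualBraidingHom_evaluation]
      dsimp only [dualBraidingHom]
      rw [halfBraiding_inv_tensor]
      monoidal

theorem halfBraiding_unit_inv {X : C} (b : HalfBraiding X) :
    (b.β (𝟙_ C)).inv = (λ_ X).hom ≫ (ρ_ X).inv := by
  have h2 := halfBraiding_inv_naturality b (λ_ (𝟙_ C)).hom
  rw [halfBraiding_inv_tensor] at h2
  have h3 : ((λ_ X).inv ≫ (b.β (𝟙_ C)).inv ≫ (ρ_ X).hom) ≫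
      ((λ_ X).inv ≫ (b.β (𝟙_ C)).inv ≫ (ρ_ X).hom) =
      (λ_ X).inv ≫ (b.β (𝟙_ C)).inv ≫ (ρ_ X).hom := by
    calc
      _ = 𝟙 _ ⊗≫ (((α_ _ _ _).hom ≫ 𝟙_ C ◁ (b.β (𝟙_ C)).inv ≫ (α_ _ _ _).inv ≫
          (b.β (𝟙_ C)).inv ▷ 𝟙_ C ≫ (α_ _ _ _).hom) ≫
          X ◁ (λ_ (𝟙_ C)).hom) ⊗≫ 𝟙 _ := by monoidal
      _ = _ := by rw [← h2]; monoidal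
  have h4 : (λ_ X).inv ≫ (b.β (𝟙_ C)).inv ≫ (ρ_ X).hom = 𝟙 X := by
    rw [← cancel_epi ((λ_ X).inv ≫ (b.β (𝟙_ C)).inv ≫ (ρ_ X).hom), h3, Category.comp_id]
  rw [Iso.inv_comp_eq, Category.comp_id] at h4
  rw [← h4]; simp

theorem dualBraidingHom_unit {X : C} (b : HalfBraiding X) (Y : C) [ExactPairing X Y] :
    dualBraidingHom b Y (𝟙_ C) = (ρ_ Y).hom ≫ (λ_ Y).inv := by
  dsimp only [dualBraidingHom]
  rw [halfBraiding_unit_inv]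
  calc
    _ = 𝟙 _ ⊗≫ (Y ◁ η_ X Y ⊗≫ ε_ X Y ▷ Y) ⊗≫ 𝟙 _ := by monoidal
    _ = _ := by rw [ExactPairing.coevaluation_evaluation'']; monoidal

/-- The inverse of `dualBraidingHom`, built from a dual pairing of `V` and `U`. -/
def dualBraidingInv {X : C} (b : HalfBraiding X) (Y : C) [ExactPairing X Y] (U V : C)
    [ExactPairing V U] : U ⊗ Y ⟶ Y ⊗ U :=
  𝟙 _ ⊗≫ (U ⊗ Y) ◁ η_ V U ⊗≫ U ◁ dualBraidingHom b Y V ▷ U ⊗≫ ε_ V U ▷ (Y ⊗ U) ⊗≫ 𝟙 _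

theorem dualBraiding_hom_inv {X : C} (b : HalfBraiding X) (Y : C) [ExactPairing X Y] (U V : C)
    [ExactPairing V U] : dualBraidingHom b Y U ≫ dualBraidingInv b Y U V = 𝟙 _ := by
  have h1 := dualBraidingHom_naturality b Y (ε_ V U)
  rw [dualBraidingHom_unit, dualBraidingHom_tensor] at h1
  dsimp only [dualBraidingInv]
  calc
    _ = 𝟙 _ ⊗≫ (dualBraidingHom b Y U ▷ (𝟙_ C) ≫ (U ⊗ Y) ◁ η_ V U) ⊗≫
        U ◁ dualBraidingHom b Y V ▷ U ⊗≫ ε_ V U ▷ (Y ⊗ U) ⊗≫ 𝟙 _ := by monoidal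
    _ = 𝟙 _ ⊗≫ (Y ⊗ U) ◁ η_ V U ⊗≫
        (((α_ _ _ _).inv ≫ (dualBraidingHom b Y U ▷ V) ≫
          (α_ _ _ _).hom ≫ (U ◁ dualBraidingHom b Y V) ≫ (α_ _ _ _).inv) ≫ ε_ V U ▷ Y) ▷ U ⊗≫
        𝟙 _ := by
      rw [← whisker_exchange]; monoidal
    _ = 𝟙 _ ⊗≫ Y ◁ (U ◁ η_ V U ⊗≫ ε_ V U ▷ U) ⊗≫ 𝟙 _ := by
      rw [← h1]; monoidal
    _ = _ := by rw [ExactPairing.coevaluation_evaluation'']; monoidal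

theorem dualBraiding_inv_hom {X : C} (b : HalfBraiding X) (Y : C) [ExactPairing X Y] (U V : C)
    [ExactPairing V U] : dualBraidingInv b Y U V ≫ dualBraidingHom b Y U = 𝟙 _ := by
  have h1 := dualBraidingHom_naturality b Y (η_ V U)
  rw [dualBraidingHom_unit, dualBraidingHom_tensor] at h1
  dsimp only [dualBraidingInv]
  calc
    _ = 𝟙 _ ⊗≫ (U ⊗ Y) ◁ η_ V U ⊗≫ U ◁ dualBraidingHom b Y V ▷ U ⊗≫
        (ε_ V U ▷ (Y ⊗ U) ≫ (𝟙_ C) ◁ dualBraidingHom b Y U) ⊗≫ 𝟙 _ := by monoidal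
    _ = 𝟙 _ ⊗≫ U ◁ (Y ◁ η_ V U ≫ ((α_ _ _ _).inv ≫ (dualBraidingHom b Y V ▷ U) ≫
          (α_ _ _ _).hom ≫ (V ◁ dualBraidingHom b Y U) ≫ (α_ _ _ _).inv)) ⊗≫
          ε_ V U ▷ (U ⊗ Y) ⊗≫ 𝟙 _ := by
      rw [← whisker_exchange]; monoidal
    _ = 𝟙 _ ⊗≫ (U ◁ η_ V U ⊗≫ ε_ V U ▷ U) ▷ Y ⊗≫ 𝟙 _ := by
      rw [h1]; monoidal
    _ = _ := by rw [ExactPairing.coevaluation_evaluation'']; monoidal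

theorem evaluation_comm_halfBraiding {X : C} (b : HalfBraiding X) (Y : C) [ExactPairing X Y]
    (U : C) :
    ε_ X Y ▷ U ≫ (λ_ U).hom ≫ (ρ_ U).inv =
      ((α_ _ _ _).hom ≫ Y ◁ (b.β U).hom ≫ (α_ _ _ _).inv ≫
        dualBraidingHom b Y U ▷ X ≫ (α_ _ _ _).hom) ≫ U ◁ ε_ X Y := by
  symm
  calc
    _ = 𝟙 _ ⊗≫ Y ◁ (b.β U).hom ⊗≫ (dualBraidingHom b Y U ▷ X ⊗≫ U ◁ ε_ X Y) := by monoidal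
    _ = 𝟙 _ ⊗≫ Y ◁ ((b.β U).hom ≫ (b.β U).inv) ⊗≫ ε_ X Y ▷ U ⊗≫ 𝟙 _ := by
      rw [dualBraidingHom_evaluation]; monoidal
    _ = _ := by rw [Iso.hom_inv_id]; monoidal

theorem coevaluation_comm_halfBraiding {X : C} (b : HalfBraiding X) (Y : C) [ExactPairing X Y]
    (U : C) :
    η_ X Y ▷ U ≫ (α_ _ _ _).hom ≫ X ◁ dualBraidingHom b Y U ≫ (α_ _ _ _).inv ≫
      (b.β U).hom ▷ Y ≫ (α_ _ _ _).hom = ((λ_ U).hom ≫ (ρ_ U).inv) ≫ U ◁ η_ X Y := by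
  calc
    _ = (𝟙 (𝟙_ C ⊗ U) ⊗≫ η_ X Y ▷ U ⊗≫ X ◁ dualBraidingHom b Y U) ⊗≫
        (b.β U).hom ▷ Y ⊗≫ 𝟙 _ := by monoidal
    _ = 𝟙 _ ⊗≫ U ◁ η_ X Y ⊗≫ ((b.β U).inv ≫ (b.β U).hom) ▷ Y ⊗≫ 𝟙 _ := by
      rw [dualBraidingHom_coevaluation]; monoidal
    _ = _ := by rw [Iso.inv_hom_id]; monoidal

variable [RigidCategory C]

/-- The dual object in the center: `X^*` with the half-braiding `dualBraidingHom`. -/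
def centerDual (X : Center C) : Center C :=
  ⟨(X.1)ᘁ,
    { β := fun U =>
        { hom := dualBraidingHom X.2 (X.1)ᘁ U
          inv := dualBraidingInv X.2 (X.1)ᘁ U (ᘁU)
          hom_inv_id := dualBraiding_hom_inv _ _ _ _
          inv_hom_id := dualBraiding_inv_hom _ _ _ _ }
      monoidal := dualBraidingHom_tensor _ _
      naturality := dualBraidingHom_naturality _ _ }⟩

/-- The evaluation of `X` in `C` is a morphism of the center. -/
def centerEv (X : Center C) : centerDual X ⊗ X ⟶ 𝟙_ (Center C) :=
  Center.Hom.mk (ε_ X.1 (X.1)ᘁ) (evaluation_comm_halfBraiding X.2 _)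

/-- The coevaluation of `X` in `C` is a morphism of the center. -/
def centerCoev (X : Center C) : 𝟙_ (Center C) ⟶ X ⊗ centerDual X :=
  Center.Hom.mk (η_ X.1 (X.1)ᘁ) (coevaluation_comm_halfBraiding X.2 _)

/-- Every object of the center of a rigid monoidal category has a dual object, with the same
evaluation and coevaluation as in `C`. -/
instance centerRightRigid : RightRigidCategory (Center C) where
  rightDual X :=
    { rightDual := centerDual X
      exact :=
        { coevaluation' := centerCoev X
          evaluation' := centerEv X
          coevaluation_evaluation' :=
            Center.ext _ _ (by
              simp only [Center.comp_f, Center.associator_inv_f, Center.leftUnitor_inv_f]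
              exact ExactPairing.coevaluation_evaluation X.1 (X.1)ᘁ)
          evaluation_coevaluation' :=
            Center.ext _ _ (by
              simp only [Center.comp_f, Center.rightUnitor_inv_f]
              exact ExactPairing.evaluation_coevaluation X.1 (X.1)ᘁ) } }

end CenterDual

section Duality
universe v u v' u'
variable {C : Type u} [Category.{v} C] [MonoidalCategory C] [RightRigidCategory C]
variable {D : Type u'} [Category.{v'} D] [MonoidalCategory D]

/-- The chosen dual object `X^*`, with `ev : X^* ⊗ X ⟶ 𝟙` and `coev : 𝟙 ⟶ X ⊗ X^*`. -/
abbrev dual (X : C) : C := Xᘁ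

/-- The evaluation `X^* ⊗ X ⟶ 𝟙`. -/
abbrev ev (X : C) : dual X ⊗ X ⟶ 𝟙_ C := ε_ X Xᘁ

/-- The coevaluation `𝟙 ⟶ X ⊗ X^*`. -/
abbrev coev (X : C) : 𝟙_ C ⟶ X ⊗ dual X := η_ X Xᘁ

/-- The chosen dual object as an exact pairing. -/
abbrev dualPairing (X : C) : ExactPairing X (dual X) := HasRightDual.exact

/-- The dual (transpose) `f^* : Y^* ⟶ X^*` of a morphism `f : X ⟶ Y`. -/
abbrev dualMap {X Y : C} (f : X ⟶ Y) : dual Y ⟶ dual X := fᘁ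

theorem dualMap_id (X : C) : dualMap (𝟙 X) = 𝟙 (dual X) := rightAdjointMate_id

theorem dualMap_comp {X Y Z : C} (f : X ⟶ Y) (g : Y ⟶ Z) :
    dualMap (f ≫ g) = dualMap g ≫ dualMap f := comp_rightAdjointMate

/-- The isomorphism `(e^*)⁻¹ = (e⁻¹)^* : X^* ≅ Y^*` for `e : X ≅ Y`. -/
def dualIso {X Y : C} (e : X ≅ Y) : dual X ≅ dual Y where
  hom := dualMap e.inv
  inv := dualMap e.hom
  hom_inv_id := by rw [← dualMap_comp, Iso.hom_inv_id, dualMap_id]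
  inv_hom_id := by rw [← dualMap_comp, Iso.inv_hom_id, dualMap_id]

/-- The unit part `𝟙 ≅ 𝟙^*` of the monoidal structure of the duality functor. -/
def unitDualIso : 𝟙_ C ≅ dual (𝟙_ C) :=
  rightDualIso exactPairingUnit (dualPairing (𝟙_ C))

/-- The unit part `δ₀ : 𝟙 ≅ 𝟙^{**}` of the monoidal structure of the double dual functor. -/
def unitDoubleDualIso : 𝟙_ C ≅ dual (dual (𝟙_ C)) :=
  unitDualIso ≪≫ dualIso unitDualIso

open Functor.LaxMonoidal Functor.OplaxMonoidal

/-- A strong monoidal functor sends a dual object to a dual object. -/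
@[reducible]
def mapPairing (F : C ⥤ D) [F.Monoidal] (X Y : C) [ExactPairing X Y] :
    ExactPairing (F.obj X) (F.obj Y) where
  coevaluation' := ε F ≫ F.map (η_ X Y) ≫ δ F X Y
  evaluation' := μ F Y X ≫ F.map (ε_ X Y) ≫ η F
  coevaluation_evaluation' := by
    have h := congrArg F.map (ExactPairing.coevaluation_evaluation X Y)
    simp only [Functor.map_comp, Functor.Monoidal.map_whiskerLeft,
      Functor.Monoidal.map_whiskerRight, Functor.Monoidal.map_associator_inv,
      Functor.Monoidal.map_rightUnitor, Functor.Monoidal.map_leftUnitor_inv,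
      Category.assoc, Functor.Monoidal.μ_δ_assoc] at h
    replace h := (cancel_epi (δ F Y (𝟙_ C))).1 h
    calc
      _ = F.obj Y ◁ ε F ≫ (F.obj Y ◁ F.map (η_ X Y) ≫ F.obj Y ◁ δ F X Y ≫
          (α_ (F.obj Y) (F.obj X) (F.obj Y)).inv ≫ μ F Y X ▷ F.obj Y ≫
          F.map (ε_ X Y) ▷ F.obj Y ≫ μ F (𝟙_ C) Y) ≫ δ F (𝟙_ C) Y ≫ η F ▷ F.obj Y := by
        simp [-μ_natural_left, -μ_natural_left_assoc]
      _ = _ := by rw [h]; simp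
  evaluation_coevaluation' := by
    have h := congrArg F.map (ExactPairing.evaluation_coevaluation X Y)
    simp only [Functor.map_comp, Functor.Monoidal.map_whiskerLeft,
      Functor.Monoidal.map_whiskerRight, Functor.Monoidal.map_associator,
      Functor.Monoidal.map_rightUnitor_inv, Functor.Monoidal.map_leftUnitor,
      Category.assoc, Functor.Monoidal.μ_δ_assoc] at h
    replace h := (cancel_epi (δ F (𝟙_ C) X)).1 h
    calc
      _ = ε F ▷ F.obj X ≫ (F.map (η_ X Y) ▷ F.obj X ≫ δ F X Y ▷ F.obj X ≫
          (α_ (F.obj X) (F.obj Y) (F.obj X)).hom ≫ F.obj X ◁ μ F Y X ≫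
          F.obj X ◁ F.map (ε_ X Y) ≫ μ F X (𝟙_ C)) ≫ δ F X (𝟙_ C) ≫ F.obj X ◁ η F := by
        simp [-μ_natural_right, -μ_natural_right_assoc]
      _ = _ := by rw [h]; simp

theorem map_dualMap (F : C ⥤ D) [F.Monoidal] {X Y : C} (f : X ⟶ Y) :
    F.map (dualMap f) = @rightAdjointMate D _ _ (F.obj X) (F.obj Y)
      (@HasRightDual.mk D _ _ _ (F.obj (dual X)) (mapPairing F X (dual X)))
      (@HasRightDual.mk D _ _ _ (F.obj (dual Y)) (mapPairing F Y (dual Y))) (F.map f) := by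
  have h : F.map (dualMap f) ▷ F.obj X ≫ (mapPairing F X (dual X)).evaluation' =
      F.obj (dual Y) ◁ F.map f ≫ (mapPairing F Y (dual Y)).evaluation' := by
    change _ ≫ μ F _ _ ≫ _ ≫ _ = _ ≫ μ F _ _ ≫ _ ≫ _
    rw [μ_natural_left_assoc, μ_natural_right_assoc, ← F.map_comp_assoc,
      ← F.map_comp_assoc, rightAdjointMate_comp_evaluation]
  have h2 := @rightAdjointMate_comp_evaluation D _ _ (F.obj X) (F.obj Y)
    (@HasRightDual.mk D _ _ _ (F.obj (dual X)) (mapPairing F X (dual X)))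
    (@HasRightDual.mk D _ _ _ (F.obj (dual Y)) (mapPairing F Y (dual Y))) (F.map f)
  exact evaluation_cancel (mapPairing F X (dual X)) (h.trans h2.symm)

variable [RightRigidCategory D]

/-- The duality transformation `ζ_X : F(X^*) ≅ F(X)^*`. -/
def dualityIso (F : C ⥤ D) [F.Monoidal] (X : C) : F.obj (dual X) ≅ dual (F.obj X) :=
  rightDualIso (mapPairing F X (dual X)) (dualPairing (F.obj X))

theorem dualityIso_hom_evaluation (F : C ⥤ D) [F.Monoidal] (X : C) :
    (dualityIso F X).hom ▷ F.obj X ≫ ev (F.obj X) = μ F (dual X) X ≫ F.map (ev X) ≫ η F := by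
  have h := @rightAdjointMate_comp_evaluation D _ _ (F.obj X) (F.obj X)
    (@HasRightDual.mk D _ _ _ (dual (F.obj X)) (dualPairing (F.obj X)))
    (@HasRightDual.mk D _ _ _ (F.obj (dual X)) (mapPairing F X (dual X))) (𝟙 (F.obj X))
  rw [MonoidalCategory.whiskerLeft_id, Category.id_comp] at h
  exact h

theorem dualityIso_naturality (F : C ⥤ D) [F.Monoidal] {X Y : C} (f : X ⟶ Y) :
    F.map (dualMap f) ≫ (dualityIso F X).hom = (dualityIso F Y).hom ≫ dualMap (F.map f) := by
  rw [map_dualMap]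
  refine (@comp_rightAdjointMate D _ _ _ _ _ (HasRightDual.mk _) (@HasRightDual.mk D _ _ _ (F.obj (dual X)) (mapPairing F X (dual X))) (@HasRightDual.mk D _ _ _ (F.obj (dual Y)) (mapPairing F Y (dual Y))) _ _).symm.trans ?_
  refine Eq.trans ?_ (@comp_rightAdjointMate D _ _ _ _ _ (HasRightDual.mk _) (@HasRightDual.mk D _ _ _ _ (dualPairing (F.obj Y))) (@HasRightDual.mk D _ _ _ (F.obj (dual Y)) (mapPairing F Y (dual Y))) _ _)
  rw [Category.comp_id, Category.id_comp]

/-- The isomorphism `ξ_X : F(X^{**}) ≅ F(X)^{**}`, that is, `ζ_{X^*}` followed by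
`(ζ_X⁻¹)^*`. -/
def doubleDualityIso (F : C ⥤ D) [F.Monoidal] (X : C) :
    F.obj (dual (dual X)) ≅ dual (dual (F.obj X)) :=
  dualityIso F (dual X) ≪≫ dualIso (dualityIso F X)

theorem doubleDualityIso_naturality (F : C ⥤ D) [F.Monoidal] {X Y : C} (f : X ⟶ Y) :
    F.map (dualMap (dualMap f)) ≫ (doubleDualityIso F Y).hom =
      (doubleDualityIso F X).hom ≫ dualMap (dualMap (F.map f)) := by
  have h : dualMap (F.map f) ≫ (dualityIso F X).inv =
      (dualityIso F Y).inv ≫ F.map (dualMap f) := by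
    rw [Iso.comp_inv_eq, Category.assoc, dualityIso_naturality, Iso.inv_hom_id_assoc]
  dsimp only [doubleDualityIso, dualIso, Iso.trans_hom]
  rw [← Category.assoc, dualityIso_naturality, Category.assoc, Category.assoc,
    ← dualMap_comp, ← dualMap_comp, h]

/-- A pivotal object of `C`: an object `V` with an isomorphism `φ : V ≅ V^{**}`. These are the
objects of the pivotal cover `C^piv`. -/
structure PivotalCover (C : Type u) [Category.{v} C] [MonoidalCategory C]
    [RightRigidCategory C] where
  obj : C
  φ : obj ≅ dual (dual obj)

namespace PivotalCover

/-- A morphism of pivotal objects: `f : V ⟶ W` with `φ_W ∘ f = f^{**} ∘ φ_V`. -/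
@[ext]
structure Hom (V W : PivotalCover C) where
  f : V.obj ⟶ W.obj
  comm : f ≫ W.φ.hom = V.φ.hom ≫ dualMap (dualMap f)

instance : Category (PivotalCover C) where
  Hom V W := Hom V W
  id V := ⟨𝟙 V.obj, by simp only [dualMap_id, Category.id_comp, Category.comp_id]⟩
  comp f g := ⟨f.f ≫ g.f, by
    rw [Category.assoc, g.comm, ← Category.assoc, f.comm, Category.assoc, ← dualMap_comp,
      ← dualMap_comp]⟩
  id_comp f := Hom.ext (Category.id_comp f.f)
  comp_id f := Hom.ext (Category.comp_id f.f)
  assoc f g h := Hom.ext (Category.assoc f.f g.f h.f)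

/-- The unit object `(𝟙, δ₀)` of the pivotal cover. -/
def unit (C : Type u) [Category.{v} C] [MonoidalCategory C] [RightRigidCategory C] :
    PivotalCover C := ⟨𝟙_ C, unitDoubleDualIso⟩

/-- The dual `(V^*, (φ^*)⁻¹)` of a pivotal object `(V, φ)`. -/
def dualObj (V : PivotalCover C) : PivotalCover C := ⟨dual V.obj, dualIso V.φ⟩

/-- The functor `F^piv : C^piv ⥤ D^piv`, `(V, φ) ↦ (F(V), ξ_V ∘ F(φ))`, induced by a strong
monoidal functor `F : C ⥤ D`. -/
def map (F : C ⥤ D) [F.Monoidal] : PivotalCover C ⥤ PivotalCover D where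
  obj V := ⟨F.obj V.obj, F.mapIso V.φ ≪≫ doubleDualityIso F V.obj⟩
  map {V W} f := ⟨F.map f.f, by
    simp only [Iso.trans_hom, Functor.mapIso_hom]
    rw [← Category.assoc, ← F.map_comp, f.comm, F.map_comp, Category.assoc,
      doubleDualityIso_naturality, Category.assoc]⟩
  map_id V := Hom.ext (F.map_id V.obj)
  map_comp f g := Hom.ext (F.map_comp f.f g.f)

end PivotalCover

end Duality

section Indicator
universe v u w
variable (k : Type w) [Field k] {C : Type u} [Category.{v} C] [MonoidalCategory C]
  [RightRigidCategory C]

/-- `V^{⊗ (m+1)} = V ⊗ (V ⊗ (⋯ ⊗ V))`. -/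
def tensorPow (V : C) : ℕ → C
  | 0 => V
  | m + 1 => V ⊗ tensorPow V m

/-- The associativity isomorphism `V^{⊗ (m+1)} ⊗ V ≅ V^{⊗ (m+2)}`. -/
def tensorPowIso (V : C) : ∀ m : ℕ, tensorPow V m ⊗ V ≅ tensorPow V (m + 1)
  | 0 => Iso.refl (V ⊗ V)
  | m + 1 => α_ V (tensorPow V m) V ≪≫ whiskerLeftIso V (tensorPowIso V m)

theorem dualMap_bijective (X Y : C) : Function.Bijective (dualMap : (X ⟶ Y) → _) := by
  have h : ∀ f : X ⟶ Y, dualMap f = (ρ_ _).inv ≫ (tensorLeftHomEquiv (𝟙_ C) Y (dual Y) _).symm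
      (tensorRightHomEquiv (𝟙_ C) X (dual X) Y ((λ_ X).hom ≫ f)) := by
    intro f
    rw [Iso.eq_inv_comp, ← tensorLeftHomEquiv_symm_coevaluation_comp_whiskerRight,
      ← tensorRightHomEquiv_symm_coevaluation_comp_whiskerRight (Y := X) (Y' := dual X) f,
      Equiv.apply_symm_apply]
  have h2 : (dualMap : (X ⟶ Y) → (dual Y ⟶ dual X)) =
      ((((λ_ X).symm.homFromEquiv (Z := Y)).trans
        (tensorRightHomEquiv (𝟙_ C) X (dual X) Y)).trans
          (tensorLeftHomEquiv (𝟙_ C) Y (dual Y) (dual X)).symm).trans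
            ((ρ_ (dual Y)).homFromEquiv) := by
    funext f
    exact h f
  rw [h2]
  exact Equiv.bijective _

variable [Preadditive C] [Linear k C] [MonoidalPreadditive C] [MonoidalLinear k C]

/-- The `k`-linear bijection `Hom(X, Y) ≅ Hom(Y^*, X^*)`, `f ↦ f^*`. -/
def dualMapEquiv (X Y : C) : (X ⟶ Y) ≃ₗ[k] (dual Y ⟶ dual X) :=
  LinearEquiv.ofBijective
    { toFun := dualMap
      map_add' := fun f g => by simp [rightAdjointMate]
      map_smul' := fun c f => by simp [rightAdjointMate] }
    (dualMap_bijective X Y)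

/-- The isomorphism `Hom(X, V ⊗ W) ≅ Hom(V^* ⊗ X, W)`. -/
def leftTransposeEquiv (X V W : C) : (X ⟶ V ⊗ W) ≃ₗ[k] (dual V ⊗ X ⟶ W) :=
  (tensorLeftHomEquiv X V (dual V) W).symm.toLinearEquiv
    ⟨fun f g => by simp [tensorLeftHomEquiv], fun c f => by simp [tensorLeftHomEquiv]⟩

/-- The isomorphism `Hom(X ⊗ V, W) ≅ Hom(X, W ⊗ V^*)`. -/
def rightTransposeEquiv (X V W : C) : (X ⊗ V ⟶ W) ≃ₗ[k] (X ⟶ W ⊗ dual V) :=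
  (tensorRightHomEquiv X V (dual V) W).toLinearEquiv
    ⟨fun f g => by simp [tensorRightHomEquiv], fun c f => by simp [tensorRightHomEquiv]⟩

/-- The isomorphism `D_{V,W} : Hom(𝟙, V ⊗ W) ≅ Hom(V^*, W) ≅ Hom(𝟙, W ⊗ V^{**})`. -/
def rotateEquiv (V W : C) : (𝟙_ C ⟶ V ⊗ W) ≃ₗ[k] (𝟙_ C ⟶ W ⊗ dual (dual V)) :=
  leftTransposeEquiv k (𝟙_ C) V W ≪≫ₗ
    Linear.homCongr k (ρ_ (dual V) ≪≫ (λ_ (dual V)).symm) (Iso.refl W) ≪≫ₗ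
      rightTransposeEquiv k (𝟙_ C) (dual V) W

/-- The map `E_V^{(m+1)}` on `Hom(𝟙, V^{⊗ (m+1)})`. For `m + 1 ≥ 2` it is `D_{V, V^{⊗ m}}`
followed by `id ⊗ φ⁻¹` and the associativity isomorphism; for `m + 1 = 1` it is
`f ↦ φ⁻¹ ∘ f^{**} ∘ δ₀`. -/
def E (V : PivotalCover C) :
    ∀ m : ℕ, (𝟙_ C ⟶ tensorPow V.obj m) ≃ₗ[k] (𝟙_ C ⟶ tensorPow V.obj m)
  | 0 => dualMapEquiv k (𝟙_ C) V.obj ≪≫ₗ dualMapEquiv k (dual V.obj) (dual (𝟙_ C)) ≪≫ₗ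
      Linear.homCongr k unitDoubleDualIso.symm V.φ.symm
  | m + 1 => rotateEquiv k V.obj (tensorPow V.obj m) ≪≫ₗ
      Linear.homCongr k (Iso.refl (𝟙_ C))
        (whiskerLeftIso (tensorPow V.obj m) V.φ.symm ≪≫ tensorPowIso V.obj m)

/-- The left pivotal dimension `ev_V ∘ (id ⊗ φ⁻¹) ∘ coev_{V^*}` of a pivotal object. -/
def leftDim (V : PivotalCover C) : 𝟙_ C ⟶ 𝟙_ C :=
  coev (dual V.obj) ≫ dual V.obj ◁ V.φ.inv ≫ ev V.obj

/-- The map `E_V^{(0)}` on `End(𝟙)`, `f ↦ leftDim V ∘ f`. -/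
def E₀ (V : PivotalCover C) : (𝟙_ C ⟶ 𝟙_ C) →ₗ[k] (𝟙_ C ⟶ 𝟙_ C) :=
  Linear.rightComp k (𝟙_ C) (leftDim V)

/-- The `(n, r)`-th Frobenius-Schur indicator of a pivotal object, for integers `n` and `r`:
the trace of `(E_V^{(n)})^r` for `n > 0`, and for `n = 0`, `r ≥ 0`; in the remaining cases it is
determined by `ν_{n,r}(V) = ν_{-n,-r}(V^*)`. -/
def indicator (V : PivotalCover C) : ℤ → ℤ → k
  | Int.ofNat (m + 1), r => LinearMap.trace k _ (E k V m ^ r).toLinearMap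
  | Int.ofNat 0, Int.ofNat s => LinearMap.trace k _ (E₀ k V ^ s)
  | Int.ofNat 0, Int.negSucc s => LinearMap.trace k _ (E₀ k V.dualObj ^ (s + 1))
  | Int.negSucc m, r => LinearMap.trace k _ (E k V.dualObj m ^ (-r)).toLinearMap

end Indicator

section FiniteTensor
universe v u w

/-- A finite tensor category over `k`: a `k`-linear abelian rigid monoidal category with
finite-dimensional spaces of morphisms, all of whose objects have finite length, with simple unit
object, and equivalent, as a `k`-linear category, to the category of finite-dimensional modules
over a finite-dimensional `k`-algebra. -/
class IsFiniteTensorCategory (k : Type w) [Field k] (C : Type u) [Category.{v} C] [Abelian C]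
    [Linear k C] [MonoidalCategory C] [MonoidalPreadditive C] [MonoidalLinear k C]
    [RigidCategory C] : Prop where
  finiteDimensional_hom : ∀ X Y : C, FiniteDimensional k (X ⟶ Y)
  finite_length : ∀ X : C, IsNoetherianObject X ∧ IsArtinianObject X
  simple_unit : Simple (𝟙_ C)
  equivalence : ∃ (A : Type w) (_ : Ring A) (_ : Algebra k A) (_ : FiniteDimensional k A)
    (e : C ≌ FGModuleCat.{w} A), e.functor.Additive ∧ e.functor.Linear k

/-- The adjoint object `U^piv (I (𝟙))`, where `U : Z(C) ⥤ C` is the forgetful functor and `I` is a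
functor from `C^piv` to `Z(C)^piv`, to be taken right adjoint to `U^piv`. -/
def adjointObject {C : Type u} [Category.{v} C] [MonoidalCategory C] [RigidCategory C]
    (I : PivotalCover C ⥤ PivotalCover (Center C)) : PivotalCover C :=
  (PivotalCover.map (Center.forget C)).obj (I.obj (PivotalCover.unit C))

end FiniteTensor
end FSIndicator

end

/-! The adjoint object is pinned down by a universal property that a monoidal equivalence preserves,
and indicators are built only from data that such an equivalence preserves.

Existence. A right adjoint of `U : Z(C) ⥤ C` at `W` is the end of `X ⊗ W ⊗ X^*` over `X`, that is,
the source `E` of a universal natural family `E ⊗ X ⟶ X ⊗ W`. Finiteness provides a progenerator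
`P`, and natural families are the same as morphisms `Y ⊗ P ⟶ P ⊗ W` commuting with `End(P)`, so `E`
is the kernel of one morphism out of `(P ⊗ W) ⊗ P^*` (`exists_isUniversal`). Universality equips `E`
with a half-braiding and makes it cofree over `W` (`Intertwiner.IsUniversal.exists_isCofree`).

Pivotal structures. Every object of the braided category `Z(C)` is isomorphic to its double dual, so
the double dual of a cofree object over `W` is cofree over `W^{**}`. An isomorphism `V ≅ V^{**}`
therefore lifts uniquely to the cofree object over `V`, which becomes cofree over `V` among pivotal
objects. Conversely every pivotal cofree object arises so (`IsPivotalCofree.isCofree`), which covers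
an arbitrary choice of adjoint.

Invariance. Half-braidings, duals and pivotal structures are transported along `F` by the relations
`CenterRelated` and `PivotalRelated`, without constructing a functor `Z(C) ⥤ Z(D)`. The transport of
a cofree object over the unit is again cofree over the unit, hence `F^piv` sends one adjoint object
to the other up to isomorphism. Since `F` commutes with rotation (`rotateEquiv_map`), the operators
`E` on the two sides are conjugate and the traces of their powers agree
(`PivotalRelated.indicator_eq`). -/

open CategoryTheory MonoidalCategory
namespace FSIndicator

/-! ### Progenerators -/

section Generator
universe v u w
open Limits

/-- A quotient of a finitely generated module is finitely generated over any ring, so the quotient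
by the range is an admissible test object; no Noetherian hypothesis enters. -/
theorem epi_surjective_of_fgModuleCat {A : Type w} [Ring A] {M N : FGModuleCat.{w} A} (f : M ⟶ N)
    [Epi f] : Function.Surjective f.hom.hom := by
  rw [← LinearMap.range_eq_top]
  set R := LinearMap.range f.hom.hom
  let Q : FGModuleCat.{w} A := FGModuleCat.of A (N ⧸ R)
  let q : N ⟶ Q := FGModuleCat.ofHom R.mkQ
  let z : N ⟶ Q := FGModuleCat.ofHom 0
  have h : q = z := by
    rw [← cancel_epi f]
    apply FGModuleCat.hom_ext
    refine LinearMap.ext fun x => ?_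
    exact (Submodule.Quotient.mk_eq_zero R).2 (LinearMap.mem_range_self _ x)
  have h2 : R.mkQ = 0 := congrArg (fun t : N ⟶ Q => t.hom.hom) h
  rw [← R.ker_mkQ, h2, LinearMap.ker_zero]

/-- A finite family of morphisms into `X` is jointly epimorphic. -/
def JointlyEpic {C : Type u} [Category.{v} C] {P X : C} {n : ℕ} (p : Fin n → (P ⟶ X)) : Prop :=
  ∀ ⦃Z : C⦄ (f g : X ⟶ Z), (∀ i, p i ≫ f = p i ≫ g) → f = g

/-- A projective object `P` such that every object is a quotient of a finite power of `P`. -/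
structure IsProgenerator {C : Type u} [Category.{v} C] (P : C) : Prop where
  projective : Projective P
  exists_jointlyEpic : ∀ X : C, ∃ (n : ℕ) (p : Fin n → (P ⟶ X)), JointlyEpic p

theorem isProgenerator_fgModuleCat (A : Type w) [Ring A] :
    IsProgenerator (FGModuleCat.of.{w} A A) where
  projective :=
    { factors := fun {E X} f e _ => by
        obtain ⟨y, hy⟩ := epi_surjective_of_fgModuleCat e (f.hom.hom 1)
        refine ⟨FGModuleCat.ofHom (LinearMap.toSpanSingleton A E y), FGModuleCat.hom_ext ?_⟩
        refine LinearMap.ext_ring ?_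
        change e.hom.hom ((1 : A) • y) = f.hom.hom 1
        rw [one_smul, hy] }
  exists_jointlyEpic X := by
    obtain ⟨n, s, hs⟩ := Module.Finite.exists_fin (R := A) (M := X)
    refine ⟨n, fun i => FGModuleCat.ofHom (LinearMap.toSpanSingleton A X (s i)),
      fun Z f g h => FGModuleCat.hom_ext ?_⟩
    refine LinearMap.ext_on_range hs fun i => ?_
    have h1 := congrArg (fun t : FGModuleCat.of.{w} A A ⟶ Z => t.hom.hom (1 : A)) (h i)
    change f.hom.hom ((1 : A) • s i) = g.hom.hom ((1 : A) • s i) at h1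
    rwa [one_smul] at h1

theorem IsProgenerator.of_equivalence {C : Type u} [Category.{v} C] {C' : Type*} [Category* C']
    (e : C ≌ C') {P : C'} (hP : IsProgenerator P) : IsProgenerator (e.inverse.obj P) where
  projective := (e.symm.map_projective_iff P).2 hP.projective
  exists_jointlyEpic X := by
    obtain ⟨n, p, hp⟩ := hP.exists_jointlyEpic (e.functor.obj X)
    refine ⟨n, fun i => e.inverse.map (p i) ≫ e.unitInv.app X, fun Z f g h => ?_⟩
    apply e.functor.map_injective
    refine hp _ _ fun i => e.inverse.map_injective ?_
    have h1 := h i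
    simp only [Category.assoc] at h1
    simp only [Functor.map_comp]
    rw [← cancel_mono (e.unitInv.app Z)]
    have h2 : ∀ f : X ⟶ Z, e.inverse.map (e.functor.map f) ≫ e.unitInv.app Z =
      e.unitInv.app X ≫ f := fun f => e.unitInv.naturality f
    rw [Category.assoc, Category.assoc, h2, h2, h1]

end Generator

/-! ### Natural families `Y ⊗ X ⟶ X ⊗ W` -/

section Intertwiner
universe v u
variable {C : Type u} [Category.{v} C] [MonoidalCategory C]

/-- A natural family of morphisms `Y ⊗ X ⟶ X ⊗ W`. -/
@[ext]
structure Intertwiner (Y W : C) where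
  app : ∀ X, Y ⊗ X ⟶ X ⊗ W
  naturality : ∀ {X X' : C} (f : X ⟶ X'), Y ◁ f ≫ app X' = app X ≫ f ▷ W

/-- An intertwiner `E ⊗ - ⟶ - ⊗ W` through which all other ones factor uniquely. -/
def Intertwiner.IsUniversal {E W : C} (τ : Intertwiner E W) : Prop :=
  ∀ ⦃Y : C⦄ (s : Intertwiner Y W), ∃! h : Y ⟶ E, ∀ X, h ▷ X ≫ τ.app X = s.app X

/-- Left rigidity enters here: it makes `Y ⊗ -` preserve epimorphisms and cokernels. -/
instance tensorLeft_isLeftAdjoint [LeftRigidCategory C] (Y : C) : (tensorLeft Y).IsLeftAdjoint :=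
  (tensorLeftAdjunction (ᘁY) Y).isLeftAdjoint

end Intertwiner

/-! ### Universal intertwiners from a progenerator -/

section Extension
universe v u
open Limits
attribute [local instance] Abelian.hasFiniteBiproducts
variable {C : Type u} [Category.{v} C] [Abelian C]

theorem epi_desc_of_jointlyEpic {P X : C} {n : ℕ} {p : Fin n → (P ⟶ X)} (hp : JointlyEpic p) :
    Epi (biproduct.desc p) where
  left_cancellation f g h := hp f g fun i => by
    have := congrArg (fun t => biproduct.ι (fun _ : Fin n => P) i ≫ t) h
    simpa using this

variable [MonoidalCategory C] [MonoidalPreadditive C] [LeftRigidCategory C]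

instance whiskerLeft_epi (Y : C) {X X' : C} (f : X ⟶ X') [Epi f] : Epi (Y ◁ f) :=
  inferInstanceAs (Epi ((tensorLeft Y).map f))

theorem jointlyEpic_whiskerLeft (Y : C) {P X : C} {n : ℕ} {p : Fin n → (P ⟶ X)}
    (hp : JointlyEpic p) : JointlyEpic fun i => Y ◁ p i := by
  intro Z f g h
  have := epi_desc_of_jointlyEpic hp
  rw [← cancel_epi (Y ◁ biproduct.desc p), biproduct.desc_eq]
  simp only [whiskerLeft_sum, Preadditive.sum_comp, whiskerLeft_comp, Category.assoc, h]

/-- A morphism `Y ⊗ P ⟶ P ⊗ W` compatible with the endomorphisms of a progenerator `P` extends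
to an intertwiner. -/
theorem exists_intertwiner_app_eq {P : C} (hP : IsProgenerator P) {Y W : C} (t : Y ⊗ P ⟶ P ⊗ W)
    (ht : ∀ a : P ⟶ P, Y ◁ a ≫ t = t ≫ a ▷ W) : ∃ s : Intertwiner Y W, s.app P = t := by
  have key : ∀ X : C, ∃ s : Y ⊗ X ⟶ X ⊗ W, ∀ p : P ⟶ X, Y ◁ p ≫ s = t ≫ p ▷ W := by
    intro X
    obtain ⟨n, p, hp⟩ := hP.exists_jointlyEpic X
    have hq := epi_desc_of_jointlyEpic hp
    set q := biproduct.desc p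
    -- The diagonal extension of `t` to `P^n`; compatibility with `End(P)` gives compatibility with
    -- every `P ⟶ P^n`.
    let tQ : Y ⊗ (⨁ fun _ : Fin n => P) ⟶ (⨁ fun _ : Fin n => P) ⊗ W :=
      ∑ i, Y ◁ biproduct.π _ i ≫ t ≫ biproduct.ι (fun _ : Fin n => P) i ▷ W
    have hQ : ∀ f : P ⟶ ⨁ fun _ : Fin n => P, Y ◁ f ≫ tQ = t ≫ f ▷ W := by
      intro f
      have hf : f = ∑ i, (f ≫ biproduct.π _ i) ≫ biproduct.ι (fun _ : Fin n => P) i := by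
        simp only [Category.assoc, ← Preadditive.comp_sum, biproduct.total, Category.comp_id]
      conv_rhs => rw [hf]
      simp only [tQ, Preadditive.comp_sum, sum_whiskerRight, comp_whiskerRight]
      refine Finset.sum_congr rfl fun i _ => ?_
      rw [← whiskerLeft_comp_assoc, ← Category.assoc, ht, Category.assoc,
        comp_whiskerRight]
    have hcolim := CokernelCofork.mapIsColimit _
      (Abelian.epiIsCokernelOfKernel _ (kernelIsKernel q)) (tensorLeft Y)
    -- Cover the kernel by copies of `P`: by `hQ` each one can be moved past `tQ`, where `q` kills
    -- it. Hence `tQ` descends along the cokernel `Y ◁ q`.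
    have h0 : Y ◁ kernel.ι q ≫ tQ ≫ q ▷ W = 0 := by
      obtain ⟨m, r, hr⟩ := hP.exists_jointlyEpic (kernel q)
      refine jointlyEpic_whiskerLeft Y hr _ _ fun i => ?_
      rw [← whiskerLeft_comp_assoc, ← Category.assoc, hQ, Category.assoc, ← comp_whiskerRight,
        Category.assoc, kernel.condition]
      simp
    obtain ⟨s, hs⟩ : ∃ s : Y ⊗ X ⟶ X ⊗ W, Y ◁ q ≫ s = tQ ≫ q ▷ W :=
      ⟨_, (CokernelCofork.IsColimit.desc' hcolim _ h0).2⟩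
    refine ⟨s, fun p' => ?_⟩
    have := hP.projective
    -- Projectivity lifts any `P ⟶ X` through `q`, so the descended morphism does not depend on the
    -- chosen cover.
    rw [← Projective.factorThru_comp p' q, whiskerLeft_comp, Category.assoc, hs, ← Category.assoc,
      hQ, Category.assoc, ← comp_whiskerRight]
  choose s hs using key
  refine ⟨⟨s, fun {X X'} f => ?_⟩, by simpa using hs P (𝟙 P)⟩
  obtain ⟨n, p, hp⟩ := hP.exists_jointlyEpic X
  refine jointlyEpic_whiskerLeft Y hp _ _ fun i => ?_
  rw [← whiskerLeft_comp_assoc, hs, ← Category.assoc, hs, Category.assoc, comp_whiskerRight]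

theorem Intertwiner.ext_of_isProgenerator {P : C} (hP : IsProgenerator P) {Y W : C}
    {s s' : Intertwiner Y W} (h : s.app P = s'.app P) : s = s' := by
  refine Intertwiner.ext (funext fun X => ?_)
  obtain ⟨n, p, hp⟩ := hP.exists_jointlyEpic X
  refine jointlyEpic_whiskerLeft Y hp _ _ fun i => ?_
  rw [s.naturality, s'.naturality, h]

/-- Over a finite tensor category, every object `W` has a universal intertwiner
`E ⊗ - ⟶ - ⊗ W`. -/
theorem exists_isUniversal {k : Type*} [Field k] [Linear k C] [MonoidalLinear k C]
    [RightRigidCategory C] {P : C} (hP : IsProgenerator P) [FiniteDimensional k (P ⟶ P)] (W : C) :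
    ∃ (E : C) (τ : Intertwiner E W), τ.IsUniversal := by
  let e (Y Z : C) := tensorRightHomEquiv Y P Pᘁ Z
  -- `M` represents `Y ↦ Hom(Y ⊗ P, P ⊗ W)`, with universal element `t₀`.
  let M : C := (P ⊗ W) ⊗ Pᘁ
  let t₀ : M ⊗ P ⟶ P ⊗ W := (e M (P ⊗ W)).symm (𝟙 M)
  have ht₀ : ∀ (Y : C) (t : Y ⊗ P ⟶ P ⊗ W), e _ _ t ▷ P ≫ t₀ = t := by
    intro Y t
    rw [← tensorRightHomEquiv_symm_naturality, Category.comp_id]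
    exact Equiv.symm_apply_apply _ _
  let b := Module.finBasis k (P ⟶ P)
  -- `c a` measures the failure of `t₀` to commute with `a`. This failure is linear in `a`, so a
  -- finite basis of `End(P)` suffices and the condition is a single kernel.
  let c (a : P ⟶ P) : M ⟶ M := e _ _ (M ◁ a ≫ t₀ - t₀ ≫ a ▷ W)
  let g : M ⟶ ⨁ fun _ : Fin (Module.finrank k (P ⟶ P)) => M := biproduct.lift fun i => c (b i)
  have hc : ∀ {Y : C} (h : Y ⟶ M), h ≫ g = 0 ↔
      ∀ a : P ⟶ P, Y ◁ a ≫ h ▷ P ≫ t₀ = (h ▷ P ≫ t₀) ≫ a ▷ W := by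
    intro Y h
    have h1 : ∀ a, h ≫ c a = 0 ↔ Y ◁ a ≫ h ▷ P ≫ t₀ = (h ▷ P ≫ t₀) ≫ a ▷ W := by
      intro a
      rw [← (e Y (P ⊗ W)).symm.injective.eq_iff, tensorRightHomEquiv_symm_naturality,
        Equiv.symm_apply_apply, Preadditive.comp_sub, whisker_exchange_assoc, Category.assoc]
      have : (e Y (P ⊗ W)).symm 0 = 0 := by simp [e, tensorRightHomEquiv]
      rw [this, sub_eq_zero]
    constructor
    · intro h2
      have h3 : ∀ i, h ≫ c (b i) = 0 := fun i => by
        have := congrArg (fun t => t ≫ biproduct.π _ i) h2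
        simpa [g] using this
      let L : (P ⟶ P) →ₗ[k] (Y ⊗ P ⟶ P ⊗ W) :=
        { toFun := fun a => Y ◁ a ≫ h ▷ P ≫ t₀ - (h ▷ P ≫ t₀) ≫ a ▷ W
          map_add' := fun a a' => by
            simp only [MonoidalPreadditive.whiskerLeft_add, MonoidalPreadditive.add_whiskerRight,
              Preadditive.add_comp, Preadditive.comp_add]
            abel
          map_smul' := fun r a => by
            simp [smul_sub] }
      have h4 : L = 0 := b.ext fun i => sub_eq_zero.2 ((h1 _).1 (h3 i))
      exact fun a => sub_eq_zero.1 (LinearMap.congr_fun h4 a)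
    · intro h2
      apply biproduct.hom_ext
      intro i
      simp only [g, Category.assoc, biproduct.lift_π, zero_comp]
      exact (h1 _).2 (h2 _)
  obtain ⟨τ, hτ⟩ := exists_intertwiner_app_eq hP (kernel.ι g ▷ P ≫ t₀)
    ((hc _).1 (kernel.condition g))
  refine ⟨kernel g, τ, fun Y s => ?_⟩
  have hs := ht₀ Y (s.app P)
  have hg : e _ _ (s.app P) ≫ g = 0 := (hc _).2 fun a => by rw [hs, s.naturality]
  have hl : ∀ h : Y ⟶ kernel g, (∀ X, h ▷ X ≫ τ.app X = s.app X) ↔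
      h ≫ kernel.ι g = e _ _ (s.app P) := by
    intro h
    have h1 : (∀ X, h ▷ X ≫ τ.app X = s.app X) ↔ h ▷ P ≫ τ.app P = s.app P := by
      refine ⟨fun h => h P, fun hh => ?_⟩
      let s' : Intertwiner Y W := ⟨fun X => h ▷ X ≫ τ.app X, fun f => by
        rw [whisker_exchange_assoc, τ.naturality, Category.assoc]⟩
      have : s' = s := Intertwiner.ext_of_isProgenerator hP hh
      exact fun X => congrArg (fun t : Intertwiner Y W => t.app X) this
    rw [h1, hτ, ← comp_whiskerRight_assoc]
    constructor
    · intro h2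
      rw [← h2]
      apply (e Y (P ⊗ W)).symm.injective
      rw [Equiv.symm_apply_apply, ← tensorRightHomEquiv_symm_naturality, Category.comp_id]
    · intro h2
      rw [h2, hs]
  refine ⟨kernel.lift g _ hg, (hl _).2 (kernel.lift_ι _ _ _), fun h hh => ?_⟩
  rw [← cancel_mono (kernel.ι g), (hl h).1 hh, kernel.lift_ι]

end Extension

/-! ### Invertibility of lax half-braidings -/

section LaxHalfBraiding
universe v u
variable {C : Type u} [Category.{v} C] [MonoidalCategory C]

/-- The candidate inverse of a component of a lax half-braiding, built from a dual pairing. -/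
def laxHalfBraidingInv {Y : C} (h : ∀ U : C, Y ⊗ U ⟶ U ⊗ Y) (U V : C) [ExactPairing V U] :
    U ⊗ Y ⟶ Y ⊗ U :=
  𝟙 _ ⊗≫ (U ⊗ Y) ◁ η_ V U ⊗≫ U ◁ h V ▷ U ⊗≫ ε_ V U ▷ (Y ⊗ U) ⊗≫ 𝟙 _

section
variable {Y : C} (h : ∀ U : C, Y ⊗ U ⟶ U ⊗ Y)
  (hn : ∀ {U V : C} (f : U ⟶ V), Y ◁ f ≫ h V = h U ≫ f ▷ Y)
  (ht : ∀ U V : C, h (U ⊗ V) = (α_ _ _ _).inv ≫ (h U ▷ V) ≫ (α_ _ _ _).hom ≫ (U ◁ h V) ≫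
    (α_ _ _ _).inv)
  (hu : h (𝟙_ C) = (ρ_ Y).hom ≫ (λ_ Y).inv)
include hn ht hu

/-- Naturality at the evaluation `U ⊗ V ⟶ 𝟙`, with the tensor and unit axioms, cancels `h U` against
`h V`; a zigzag identity remains. The other composite uses the coevaluation instead. -/
theorem laxHalfBraiding_hom_inv (U V : C) [ExactPairing V U] :
    h U ≫ laxHalfBraidingInv h U V = 𝟙 _ := by
  have h1 := hn (ε_ V U)
  rw [hu, ht] at h1
  dsimp only [laxHalfBraidingInv]
  calc
    _ = 𝟙 _ ⊗≫ (h U ▷ (𝟙_ C) ≫ (U ⊗ Y) ◁ η_ V U) ⊗≫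
        U ◁ h V ▷ U ⊗≫ ε_ V U ▷ (Y ⊗ U) ⊗≫ 𝟙 _ := by monoidal
    _ = 𝟙 _ ⊗≫ (Y ⊗ U) ◁ η_ V U ⊗≫
        (((α_ _ _ _).inv ≫ (h U ▷ V) ≫
          (α_ _ _ _).hom ≫ (U ◁ h V) ≫ (α_ _ _ _).inv) ≫ ε_ V U ▷ Y) ▷ U ⊗≫
        𝟙 _ := by
      rw [← whisker_exchange]; monoidal
    _ = 𝟙 _ ⊗≫ Y ◁ (U ◁ η_ V U ⊗≫ ε_ V U ▷ U) ⊗≫ 𝟙 _ := by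
      rw [← h1]; monoidal
    _ = _ := by rw [ExactPairing.coevaluation_evaluation'']; monoidal

theorem laxHalfBraiding_inv_hom (U V : C) [ExactPairing V U] :
    laxHalfBraidingInv h U V ≫ h U = 𝟙 _ := by
  have h1 := hn (η_ V U)
  rw [hu, ht] at h1
  dsimp only [laxHalfBraidingInv]
  calc
    _ = 𝟙 _ ⊗≫ (U ⊗ Y) ◁ η_ V U ⊗≫ U ◁ h V ▷ U ⊗≫
        (ε_ V U ▷ (Y ⊗ U) ≫ (𝟙_ C) ◁ h U) ⊗≫ 𝟙 _ := by monoidal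
    _ = 𝟙 _ ⊗≫ U ◁ (Y ◁ η_ V U ≫ ((α_ _ _ _).inv ≫ (h V ▷ U) ≫
          (α_ _ _ _).hom ≫ (V ◁ h U) ≫ (α_ _ _ _).inv)) ⊗≫
          ε_ V U ▷ (U ⊗ Y) ⊗≫ 𝟙 _ := by
      rw [← whisker_exchange]; monoidal
    _ = 𝟙 _ ⊗≫ (U ◁ η_ V U ⊗≫ ε_ V U ▷ U) ▷ Y ⊗≫ 𝟙 _ := by
      rw [h1]; monoidal
    _ = _ := by rw [ExactPairing.coevaluation_evaluation'']; monoidal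

end

/-- In a left rigid category, a lax half-braiding is invertible. -/
def halfBraidingOfLax [LeftRigidCategory C] {Y : C} (h : ∀ U : C, Y ⊗ U ⟶ U ⊗ Y)
    (hn : ∀ {U V : C} (f : U ⟶ V), Y ◁ f ≫ h V = h U ≫ f ▷ Y)
    (ht : ∀ U V : C, h (U ⊗ V) = (α_ _ _ _).inv ≫ (h U ▷ V) ≫ (α_ _ _ _).hom ≫ (U ◁ h V) ≫
      (α_ _ _ _).inv)
    (hu : h (𝟙_ C) = (ρ_ Y).hom ≫ (λ_ Y).inv) : HalfBraiding Y where
  β U :=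
    { hom := h U
      inv := laxHalfBraidingInv h U (ᘁU)
      hom_inv_id := laxHalfBraiding_hom_inv h hn ht hu _ _
      inv_hom_id := laxHalfBraiding_inv_hom h hn ht hu _ _ }
  monoidal := ht
  naturality := hn

end LaxHalfBraiding

/-! ### Cofree objects of the center -/

section Cofree
universe v u
variable {C : Type u} [Category.{v} C] [MonoidalCategory C]

/-- `e : X ⟶ W` exhibits the object `X` of the center as cofree over `W`. -/
def IsCofree (X : Center C) {W : C} (e : X.1 ⟶ W) : Prop :=
  ∀ (K : Center C) (g : K.1 ⟶ W), ∃! h : K ⟶ X, h.f ≫ e = g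

/-- Transposing `U` to the left turns such a family into an intertwiner out of `U^* ⊗ Y`. The case
`Y = E ⊗ U` produces the half-braiding, and uniqueness is the test for all its axioms. -/
theorem Intertwiner.IsUniversal.existsUnique_tensor [RightRigidCategory C] {E W : C}
    {τ : Intertwiner E W} (hτ : τ.IsUniversal) (U : C) {Y : C}
    (s : ∀ X : C, Y ⊗ X ⟶ U ⊗ (X ⊗ W))
    (hs : ∀ {X X' : C} (f : X ⟶ X'), Y ◁ f ≫ s X' = s X ≫ U ◁ f ▷ W) :
    ∃! h : Y ⟶ U ⊗ E, ∀ X, h ▷ X ≫ (α_ _ _ _).hom ≫ U ◁ τ.app X = s X := by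
  let e (Y Z : C) := tensorLeftHomEquiv Y U Uᘁ Z
  let s' : Intertwiner (Uᘁ ⊗ Y) W :=
    ⟨fun X => (α_ _ _ _).hom ≫ (e _ _).symm (s X), fun {X X'} f => by
      rw [← cancel_epi (α_ _ _ _).inv]
      simp only [tensor_whiskerLeft, Category.assoc, Iso.inv_hom_id_assoc]
      rw [← tensorLeftHomEquiv_symm_naturality, hs, Equiv.symm_apply_eq,
        tensorLeftHomEquiv_naturality, Equiv.apply_symm_apply]⟩
  have hh : ∀ (h : Uᘁ ⊗ Y ⟶ E) (X : C), h ▷ X ≫ τ.app X = s'.app X ↔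
      (e _ _ h) ▷ X ≫ (α_ _ _ _).hom ≫ U ◁ τ.app X = s X := by
    intro h X
    have : e _ _ ((α_ _ _ _).inv ≫ h ▷ X ≫ τ.app X) =
        (e _ _ h) ▷ X ≫ (α_ _ _ _).hom ≫ U ◁ τ.app X := by
      rw [← Category.assoc, tensorLeftHomEquiv_naturality]
      simp only [e, tensorLeftHomEquiv, Equiv.coe_fn_mk]
      monoidal
    rw [← this, ← Equiv.eq_symm_apply, Iso.inv_comp_eq]
  obtain ⟨h, h1, h2⟩ := hτ s'
  refine ⟨e _ _ h, fun X => (hh h X).1 (h1 X), fun h' hh' => ?_⟩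
  rw [← Equiv.symm_apply_eq]
  exact h2 _ fun X => (hh _ X).2 (by rw [Equiv.apply_symm_apply]; exact hh' X)

/-- The source of a universal intertwiner carries a half-braiding, and is cofree over the
target. -/
theorem Intertwiner.IsUniversal.exists_isCofree [RigidCategory C] {E W : C}
    {τ : Intertwiner E W} (hτ : τ.IsUniversal) :
    ∃ (X : Center C) (e : X.1 ⟶ W), IsCofree X e := by
  have hs : ∀ (U : C) {X X' : C} (f : X ⟶ X'),
      (E ⊗ U) ◁ f ≫ (α_ _ _ _).hom ≫ τ.app (U ⊗ X') ≫ (α_ _ _ _).hom =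
        ((α_ _ _ _).hom ≫ τ.app (U ⊗ X) ≫ (α_ _ _ _).hom) ≫ U ◁ f ▷ W := by
    intro U X X' f
    have := τ.naturality (U ◁ f)
    simp only [tensor_whiskerLeft, Category.assoc, Iso.inv_hom_id_assoc, reassoc_of% this]
    monoidal
  -- `b U` is the morphism `E ⊗ U ⟶ U ⊗ E` through which `τ.app (U ⊗ X)` factors via `τ.app X`, for
  -- all `X`.
  choose b hb _ using fun U => hτ.existsUnique_tensor U _ (hs U)
  have hext : ∀ (U : C) {Y : C} (f g : Y ⟶ U ⊗ E),
      (∀ X, f ▷ X ≫ (α_ _ _ _).hom ≫ U ◁ τ.app X = g ▷ X ≫ (α_ _ _ _).hom ≫ U ◁ τ.app X) →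
      f = g := by
    intro U Y f g hfg
    refine (hτ.existsUnique_tensor U (fun X => f ▷ X ≫ (α_ _ _ _).hom ≫ U ◁ τ.app X) ?_).unique
      (fun X => rfl) fun X => (hfg X).symm
    intro X X' a
    rw [whisker_exchange_assoc, Category.assoc, Category.assoc, ← whiskerLeft_comp,
      ← τ.naturality]
    monoidal
  have hn : ∀ {U V : C} (f : U ⟶ V), E ◁ f ≫ b V = b U ≫ f ▷ E := by
    intro U V f
    refine hext _ _ _ fun X => ?_
    have h1 := τ.naturality (f ▷ X)
    calc
      _ = (E ◁ f) ▷ X ≫ (α_ _ _ _).hom ≫ τ.app (V ⊗ X) ≫ (α_ _ _ _).hom := by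
        rw [comp_whiskerRight, Category.assoc, hb]
      _ = (α_ _ _ _).hom ≫ (E ◁ f ▷ X ≫ τ.app (V ⊗ X)) ≫ (α_ _ _ _).hom := by monoidal
      _ = ((α_ _ _ _).hom ≫ τ.app (U ⊗ X) ≫ (α_ _ _ _).hom) ≫ f ▷ (X ⊗ W) := by
        rw [h1]; monoidal
      _ = b U ▷ X ≫ (α_ _ _ _).hom ≫ U ◁ τ.app X ≫ f ▷ (X ⊗ W) := by
        rw [← hb]; simp only [Category.assoc]
      _ = _ := by rw [whisker_exchange]; monoidal
  have hu : b (𝟙_ C) = (ρ_ E).hom ≫ (λ_ E).inv := by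
    refine hext _ _ _ fun X => ?_
    have h1 := τ.naturality (λ_ X).hom
    rw [hb, ← cancel_mono (λ_ (X ⊗ W)).hom]
    calc
      _ = (α_ _ _ _).hom ≫ τ.app (𝟙_ C ⊗ X) ≫ (λ_ X).hom ▷ W := by monoidal
      _ = _ := by rw [← h1]; monoidal
  have ht : ∀ U V : C, b (U ⊗ V) = (α_ _ _ _).inv ≫ (b U ▷ V) ≫ (α_ _ _ _).hom ≫ (U ◁ b V) ≫
      (α_ _ _ _).inv := by
    intro U V
    refine hext _ _ _ fun X => ?_
    have h1 := τ.naturality (α_ U V X).hom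
    rw [hb]
    symm
    calc
      _ = (α_ _ _ _).inv ▷ X ≫ b U ▷ V ▷ X ⊗≫ U ◁ (b V ▷ X ≫ (α_ _ _ _).hom ≫ V ◁ τ.app X) ⊗≫
          𝟙 _ := by monoidal
      _ = 𝟙 _ ⊗≫ (b U ▷ (V ⊗ X) ≫ (α_ _ _ _).hom ≫ U ◁ τ.app (V ⊗ X)) ⊗≫ 𝟙 _ := by
        rw [hb]; monoidal
      _ = 𝟙 _ ⊗≫ (E ◁ (α_ U V X).hom ≫ τ.app (U ⊗ (V ⊗ X))) ⊗≫ 𝟙 _ := by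
        rw [hb]; monoidal
      _ = _ := by rw [h1]; monoidal
  -- The counit is the component of `τ` at the unit; by `he` it recovers all of `τ` from the
  -- half-braiding.
  let e : E ⟶ W := (ρ_ E).inv ≫ τ.app (𝟙_ C) ≫ (λ_ W).hom
  have he : ∀ U, b U ≫ U ◁ e = τ.app U := by
    intro U
    have h1 := τ.naturality (ρ_ U).hom
    have h2 := hb U (𝟙_ C)
    rw [← cancel_epi (E ◁ (ρ_ U).hom), h1]
    calc
      _ = (α_ _ _ _).inv ≫ (b U ▷ 𝟙_ C ≫ (α_ _ _ _).hom ≫ U ◁ τ.app (𝟙_ C)) ≫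
          U ◁ (λ_ W).hom := by
        simp only [e]; monoidal
      _ = _ := by rw [h2]; monoidal
  refine ⟨⟨E, halfBraidingOfLax b hn ht hu⟩, e, fun K g => ?_⟩
  have hg : ∀ {X X' : C} (f : X ⟶ X'), K.1 ◁ f ≫ (K.2.β X').hom ≫ X' ◁ g =
      ((K.2.β X).hom ≫ X ◁ g) ≫ f ▷ W := by
    intro X X' f
    rw [HalfBraiding.naturality_assoc, ← whisker_exchange, Category.assoc]
  -- The half-braiding of `K` followed by `g` is an intertwiner; its classifying morphism is the
  -- lift of `g`.
  obtain ⟨h, h1, h2⟩ := hτ ⟨fun U => (K.2.β U).hom ≫ U ◁ g, hg⟩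
  replace h1 : ∀ U, h ▷ U ≫ τ.app U = (K.2.β U).hom ≫ U ◁ g := h1
  refine ⟨⟨h, fun U => ?_⟩, ?_, ?_⟩
  · change h ▷ U ≫ b U = _
    refine hext _ _ _ fun X => ?_
    rw [comp_whiskerRight, Category.assoc, hb]
    calc
      _ = (α_ _ _ _).hom ≫ (h ▷ (U ⊗ X) ≫ τ.app (U ⊗ X)) ≫ (α_ _ _ _).hom := by monoidal
      _ = 𝟙 _ ⊗≫ (K.2.β U).hom ▷ X ⊗≫ U ◁ ((K.2.β X).hom ≫ X ◁ g) := by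
        rw [h1, K.2.monoidal]; monoidal
      _ = _ := by rw [← h1]; monoidal
  · change h ≫ e = g
    have h3 := h1 (𝟙_ C)
    rw [← he, hu] at h3
    have h4 := halfBraiding_unit_inv K.2
    have h5 : (K.2.β (𝟙_ C)).hom = (ρ_ _).hom ≫ (λ_ _).inv := by
      rw [← cancel_mono (K.2.β (𝟙_ C)).inv, Iso.hom_inv_id, h4]; simp
    rw [h5] at h3
    rw [← cancel_epi (ρ_ K.1).hom, ← cancel_mono (λ_ W).inv]
    calc
      _ = h ▷ 𝟙_ C ≫ ((ρ_ E).hom ≫ (λ_ E).inv) ≫ 𝟙_ C ◁ e := by simp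
      _ = _ := by rw [h3]; simp
  · intro h' hh'
    refine Center.ext _ _ (h2 _ fun U => ?_)
    change h'.f ≫ e = g at hh'
    dsimp only
    have h3 := h'.comm U
    change _ ≫ b U = _ at h3
    rw [← he, ← hh', reassoc_of% h3, whiskerLeft_comp _ h'.f e]

/-- Over every object of a finite tensor category there is a cofree object of the center. -/
theorem exists_isCofree (k : Type*) [Field k] {C : Type u} [Category.{v} C] [Abelian C]
    [Linear k C] [MonoidalCategory C] [MonoidalPreadditive C] [MonoidalLinear k C]
    [RigidCategory C] [IsFiniteTensorCategory k C] (W : C) :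
    ∃ (X : Center C) (e : X.1 ⟶ W), IsCofree X e := by
  obtain ⟨A, _, _, _, e, _⟩ := IsFiniteTensorCategory.equivalence (k := k) (C := C)
  have hP := (isProgenerator_fgModuleCat A).of_equivalence e
  have := IsFiniteTensorCategory.finiteDimensional_hom (k := k)
    (e.inverse.obj (FGModuleCat.of A A)) (e.inverse.obj (FGModuleCat.of A A))
  obtain ⟨E, τ, hτ⟩ := exists_isUniversal (k := k) hP W
  exact hτ.exists_isCofree

end Cofree

/-! ### Pivotal structures on cofree objects and the right adjoint of `U^piv` -/

section PivotalCofree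
universe v u
variable {C : Type u} [Category.{v} C] [MonoidalCategory C]

/-- In a braided category with right duals, every object is isomorphic to its double dual. -/
def doubleDualIsoOfBraided [BraidedCategory C] [RightRigidCategory C] (X : C) :
    X ≅ dual (dual X) :=
  rightDualIso (BraidedCategory.exactPairing_swap X (dual X)) (dualPairing (dual X))

variable [RigidCategory C]

theorem centerDualMap_f {X Y : Center C} (f : X ⟶ Y) : (dualMap f).f = dualMap f.f := by
  simp only [dualMap, rightAdjointMate, Center.comp_f, Center.whiskerLeft_f,
    Center.whiskerRight_f, Center.associator_inv_f, Center.leftUnitor_hom_f,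
    Center.rightUnitor_inv_f]
  rfl

theorem centerDualMap_dualMap_f {X Y : Center C} (f : X ⟶ Y) :
    (dualMap (dualMap f)).f = dualMap (dualMap f.f) :=
  (centerDualMap_f _).trans (congrArg dualMap (centerDualMap_f f))

/-- The double dual of a morphism out of an object underlying an object `X` of the center, as a
morphism out of the object underlying `X^{**}`. -/
noncomputable def forgetDoubleDual {X : Center C} {W : C} (e : X.1 ⟶ W) :
    (dual (dual X)).1 ⟶ dual (dual W) :=
  dualMap (dualMap e)

theorem forgetDoubleDual_bijective (X : Center C) (W : C) :
    Function.Bijective (forgetDoubleDual : (X.1 ⟶ W) → _) :=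
  (dualMap_bijective _ _).comp (dualMap_bijective X.1 W)

theorem dualMap_comp_forgetDoubleDual {X Y : Center C} (h : X ⟶ Y) {W : C} (e : Y.1 ⟶ W) :
    (dualMap (dualMap h)).f ≫ forgetDoubleDual e = forgetDoubleDual (h.f ≫ e) := by
  have h1 : forgetDoubleDual (h.f ≫ e) = dualMap (dualMap h.f) ≫ dualMap (dualMap e) := by
    rw [← dualMap_comp, ← dualMap_comp]
    rfl
  exact (congrArg (fun t => t ≫ dualMap (dualMap e)) (centerDualMap_dualMap_f h)).trans h1.symm

/-- The double dual is bijective on morphisms, both in the center and out of underlying objects. A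
test object `K` is replaced by `K^{**}` through the isomorphism `j` given by the braiding. -/
theorem IsCofree.doubleDual {X : Center C} {W : C} {e : X.1 ⟶ W} (he : IsCofree X e) :
    IsCofree (dual (dual X)) (forgetDoubleDual e) := by
  have bijZ : ∀ Y Z : Center C, Function.Bijective fun f : Y ⟶ Z => dualMap (dualMap f) :=
    fun Y Z => (dualMap_bijective _ _).comp (dualMap_bijective Y Z)
  intro K g
  let j := doubleDualIsoOfBraided K
  have hj : j.hom.f ≫ j.inv.f = 𝟙 _ := congrArg Center.Hom.f j.hom_inv_id
  have hj' : j.inv.f ≫ j.hom.f = 𝟙 _ := congrArg Center.Hom.f j.inv_hom_id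
  obtain ⟨g₀, hg₀⟩ := (forgetDoubleDual_bijective K W).2 (j.inv.f ≫ g)
  obtain ⟨h₀, hh₀, hu⟩ := he K g₀
  have key : ∀ h : K ⟶ X, (j.hom ≫ dualMap (dualMap h)).f ≫ forgetDoubleDual e = g ↔
      h.f ≫ e = g₀ := by
    intro h
    rw [← (forgetDoubleDual_bijective K W).1.eq_iff, hg₀, Center.comp_f, Category.assoc,
      dualMap_comp_forgetDoubleDual]
    constructor
    · intro h1
      rw [← h1, ← Category.assoc, hj', Category.id_comp]
    · intro h1
      rw [h1, ← Category.assoc, hj, Category.id_comp]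
  refine ⟨j.hom ≫ dualMap (dualMap h₀), (key h₀).2 hh₀, fun h hh => ?_⟩
  obtain ⟨h', hh'⟩ := (bijZ K X).2 (j.inv ≫ h)
  obtain rfl : h = j.hom ≫ dualMap (dualMap h') := ((Iso.eq_inv_comp _).1 hh').symm
  rw [hu h' ((key h').1 hh)]

/-- Duals in the center have the evaluation of `C`, and the forgetful functor has identity structure
morphisms. -/
theorem dualityIso_forget_hom (X : Center C) : (dualityIso (Center.forget C) X).hom = 𝟙 _ := by
  apply evaluation_cancel (dualPairing X.1)
  refine (dualityIso_hom_evaluation (Center.forget C) X).trans ?_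
  refine (Category.id_comp _).trans ((Category.comp_id _).trans ?_)
  refine Eq.trans ?_ (congrArg (fun t => t ≫ ev X.1) (id_whiskerRight _ _)).symm
  exact (Category.id_comp _).symm

theorem doubleDualityIso_forget_hom (X : Center C) :
    (doubleDualityIso (Center.forget C) X).hom = 𝟙 _ := by
  have h : (dualityIso (Center.forget C) X).inv = 𝟙 _ := by
    have h1 := (dualityIso (Center.forget C) X).inv_hom_id
    rw [dualityIso_forget_hom] at h1
    exact (Category.comp_id _).symm.trans h1
  simp only [doubleDualityIso, dualIso, Iso.trans_hom]
  rw [dualityIso_forget_hom, h]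
  exact (congrArg (fun t => 𝟙 _ ≫ t) (dualMap_id _)).trans (Category.id_comp _)

theorem map_forget_obj_φ_hom (X : PivotalCover (Center C)) :
    ((PivotalCover.map (Center.forget C)).obj X).φ.hom = X.φ.hom.f := by
  refine (congrArg (fun t => X.φ.hom.f ≫ t) (doubleDualityIso_forget_hom X.obj)).trans ?_
  exact Category.comp_id _

/-- `e : U^piv X ⟶ V` exhibits the pivotal object `X` of the center as cofree over `V`. -/
def IsPivotalCofree (X : PivotalCover (Center C)) {V : PivotalCover C}
    (e : (PivotalCover.map (Center.forget C)).obj X ⟶ V) : Prop :=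
  ∀ (K : PivotalCover (Center C)) (g : (PivotalCover.map (Center.forget C)).obj K ⟶ V),
    ∃! h : K ⟶ X, (PivotalCover.map (Center.forget C)).map h ≫ e = g

/-- The morphism of `C` underlying a morphism `U^piv X ⟶ V`. -/
def underlyingHom {X : PivotalCover (Center C)} {V : PivotalCover C}
    (e : (PivotalCover.map (Center.forget C)).obj X ⟶ V) : X.obj.1 ⟶ V.obj := e.f

theorem underlyingHom_injective {X : PivotalCover (Center C)} {V : PivotalCover C} :
    Function.Injective (underlyingHom (X := X) (V := V)) :=
  fun _ _ h => PivotalCover.Hom.ext h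

theorem underlyingHom_comm {X : PivotalCover (Center C)} {V : PivotalCover C}
    (e : (PivotalCover.map (Center.forget C)).obj X ⟶ V) :
    underlyingHom e ≫ V.φ.hom = X.φ.hom.f ≫ forgetDoubleDual (underlyingHom e) :=
  e.comm.trans (congrArg (fun t => t ≫ forgetDoubleDual (underlyingHom e))
    (map_forget_obj_φ_hom X))

theorem exists_underlyingHom_eq {X : PivotalCover (Center C)} {V : PivotalCover C}
    (e : X.obj.1 ⟶ V.obj) (he : e ≫ V.φ.hom = X.φ.hom.f ≫ forgetDoubleDual e) :
    ∃ e' : (PivotalCover.map (Center.forget C)).obj X ⟶ V, underlyingHom e' = e :=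
  ⟨⟨e, he.trans (congrArg (fun t => t ≫ forgetDoubleDual e) (map_forget_obj_φ_hom X).symm)⟩, rfl⟩

/-- The lift in the center is automatically pivotal: the two sides of the required square are lifts
of one morphism to `X^{**}`, which is cofree over `V^{**}`. -/
theorem IsCofree.isPivotalCofree {X : PivotalCover (Center C)} {V : PivotalCover C}
    {e : (PivotalCover.map (Center.forget C)).obj X ⟶ V} (he : IsCofree X.obj (underlyingHom e)) :
    IsPivotalCofree X e := by
  intro K g
  obtain ⟨h, hh, hu⟩ := he K.obj (underlyingHom g)
  have comm : h ≫ X.φ.hom = K.φ.hom ≫ dualMap (dualMap h) := by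
    refine (he.doubleDual K.obj (underlyingHom g ≫ V.φ.hom)).unique ?_ ?_
    · rw [Center.comp_f, Category.assoc, ← underlyingHom_comm, ← Category.assoc, hh]
    · rw [Center.comp_f, Category.assoc, dualMap_comp_forgetDoubleDual, hh, underlyingHom_comm]
  refine ⟨⟨h, comm⟩, underlyingHom_injective hh, fun h' hh' => PivotalCover.Hom.ext ?_⟩
  exact hu _ (congrArg underlyingHom hh')

theorem IsCofree.exists_pivotal {X : Center C} (V : PivotalCover C)
    {e : X.1 ⟶ V.obj} (he : IsCofree X e) :
    ∃ (Y : PivotalCover (Center C)) (e' : (PivotalCover.map (Center.forget C)).obj Y ⟶ V),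
      IsCofree Y.obj (underlyingHom e') := by
  obtain ⟨a, ha, -⟩ := he.doubleDual X (e ≫ V.φ.hom)
  -- Both `X`, through `φ ∘ e`, and `X^{**}` are cofree over `V^{**}`; the comparison isomorphism is
  -- the pivotal structure.
  have he' : ∀ (K : Center C) (g : K.1 ⟶ dual (dual V.obj)),
      ∃! h : K ⟶ X, h.f ≫ e ≫ V.φ.hom = g := by
    intro K g
    have := he K (g ≫ V.φ.inv)
    simpa only [← Category.assoc, Iso.eq_comp_inv] using this
  obtain ⟨b, hb, -⟩ := he' (dual (dual X)) (forgetDoubleDual e)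
  have hab : a ≫ b = 𝟙 X := by
    refine (he' X (e ≫ V.φ.hom)).unique ?_ ?_
    · rw [Center.comp_f, Category.assoc, hb, ha]
    · exact Category.id_comp _
  have hba : b ≫ a = 𝟙 (dual (dual X)) := by
    refine (he.doubleDual (dual (dual X)) (forgetDoubleDual e)).unique ?_ ?_
    · rw [Center.comp_f, Category.assoc, ha, hb]
    · exact Category.id_comp _
  let Y : PivotalCover (Center C) := ⟨X, ⟨a, b, hab, hba⟩⟩
  obtain ⟨e', rfl⟩ := exists_underlyingHom_eq (X := Y) e ha.symm
  exact ⟨Y, e', he⟩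

/-- Some pivotal cofree object has a cofree underlying object, and `X` is a retract of it compatibly
with the counits, which is enough. -/
theorem IsPivotalCofree.isCofree {X : PivotalCover (Center C)} {V : PivotalCover C}
    {e : (PivotalCover.map (Center.forget C)).obj X ⟶ V} (h : IsPivotalCofree X e)
    (hV : ∃ (Y : Center C) (e' : Y.1 ⟶ V.obj), IsCofree Y e') :
    IsCofree X.obj (underlyingHom e) := by
  obtain ⟨Y, e', he'⟩ := hV
  obtain ⟨Z, z, hz⟩ := he'.exists_pivotal
  obtain ⟨a, ha, -⟩ := h Z z
  obtain ⟨b, hb, -⟩ := hz.isPivotalCofree X e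
  have hba : b ≫ a = 𝟙 X := (h X e).unique
    (by rw [Functor.map_comp, Category.assoc, ha, hb])
    (by rw [CategoryTheory.Functor.map_id, Category.id_comp])
  have ha' : a.f.f ≫ underlyingHom e = underlyingHom z := congrArg underlyingHom ha
  have hb' : b.f.f ≫ underlyingHom z = underlyingHom e := congrArg underlyingHom hb
  have hba' : b.f ≫ a.f = 𝟙 X.obj := congrArg PivotalCover.Hom.f hba
  intro K g
  obtain ⟨t, ht, hu⟩ := hz K g
  refine ⟨t ≫ a.f, ?_, fun t' ht' => ?_⟩
  · beta_reduce
    rw [Center.comp_f, Category.assoc, ha', ht]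
  · beta_reduce at ht'
    rw [← hu (t' ≫ b.f) (by beta_reduce; rw [Center.comp_f, Category.assoc, hb', ht']),
      Category.assoc, hba', Category.comp_id]

theorem isPivotalCofree_of_adjunction {I : PivotalCover C ⥤ PivotalCover (Center C)}
    (adj : PivotalCover.map (Center.forget C) ⊣ I) (V : PivotalCover C) :
    IsPivotalCofree (I.obj V) (adj.counit.app V) := by
  intro K g
  refine ⟨adj.homEquiv _ _ g, ?_, fun h hh => ?_⟩
  · exact (adj.homEquiv_counit _ _ _).symm.trans (Equiv.symm_apply_apply _ _)
  · rw [← Equiv.symm_apply_eq]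
    exact (adj.homEquiv_counit _ _ _).trans hh

open Limits in
theorem isLeftAdjoint_map_forget (k : Type*) [Field k] (C : Type u) [Category.{v} C] [Abelian C]
    [Linear k C] [MonoidalCategory C] [MonoidalPreadditive C] [MonoidalLinear k C]
    [RigidCategory C] [IsFiniteTensorCategory k C] :
    (PivotalCover.map (Center.forget C)).IsLeftAdjoint := by
  have (V : PivotalCover C) :
      HasTerminal (CostructuredArrow (PivotalCover.map (Center.forget C)) V) := by
    obtain ⟨X, e, he⟩ := exists_isCofree k V.obj
    obtain ⟨Y, y, hy⟩ := he.exists_pivotal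
    have hy := hy.isPivotalCofree
    refine IsTerminal.hasTerminal (X := CostructuredArrow.mk y)
      (IsTerminal.ofUniqueHom (fun K => ?_) fun K m => ?_)
    · exact CostructuredArrow.homMk (hy K.left K.hom).choose (hy K.left K.hom).choose_spec.1
    · apply CostructuredArrow.hom_ext
      exact (hy K.left K.hom).choose_spec.2 _ (CostructuredArrow.w m)
  exact isLeftAdjoint_of_costructuredArrowTerminals _

end PivotalCofree

/-! ### Transport of half-braidings along a monoidal functor -/

section CenterRelated
universe v u v' u'
open Functor.LaxMonoidal Functor.OplaxMonoidal
variable {C : Type u} [Category.{v} C] [MonoidalCategory C]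
  {D : Type u'} [Category.{v'} D] [MonoidalCategory D] (F : C ⥤ D) [F.Monoidal]

theorem map_tensor_halfBraiding {X U U' : C} (f : X ⊗ U ⟶ U ⊗ X) (g : X ⊗ U' ⟶ U' ⊗ X) :
    μ F X (U ⊗ U') ≫ F.map ((α_ _ _ _).inv ≫ f ▷ U' ≫ (α_ _ _ _).hom ≫ U ◁ g ≫
      (α_ _ _ _).inv) ≫ δ F (U ⊗ U') X =
    F.obj X ◁ δ F U U' ≫ (α_ _ _ _).inv ≫ (μ F X U ≫ F.map f ≫ δ F U X) ▷ F.obj U' ≫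
      (α_ _ _ _).hom ≫ F.obj U ◁ (μ F X U' ≫ F.map g ≫ δ F U' X) ≫ (α_ _ _ _).inv ≫
      μ F U U' ▷ F.obj X := by
  simp only [Functor.map_comp, Functor.Monoidal.map_associator,
    Functor.Monoidal.map_associator_inv, Functor.Monoidal.map_whiskerLeft,
    Functor.Monoidal.map_whiskerRight, Category.assoc, Functor.Monoidal.μ_δ_assoc,
    Functor.Monoidal.μ_δ, Category.comp_id, comp_whiskerRight, whiskerLeft_comp]

theorem tensor_halfBraiding_naturality {P V V' T T' : D} {b : P ⊗ V ⟶ V ⊗ P}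
    {b' : P ⊗ V' ⟶ V' ⊗ P} {c : P ⊗ T ⟶ T ⊗ P} {c' : P ⊗ T' ⟶ T' ⊗ P} {e : T ⟶ V} {e' : T' ⟶ V'}
    (h : P ◁ e ≫ b = c ≫ e ▷ P) (h' : P ◁ e' ≫ b' = c' ≫ e' ▷ P) :
    P ◁ (e ⊗ₘ e') ≫ (α_ _ _ _).inv ≫ b ▷ V' ≫ (α_ _ _ _).hom ≫ V ◁ b' ≫ (α_ _ _ _).inv =
      ((α_ _ _ _).inv ≫ c ▷ T' ≫ (α_ _ _ _).hom ≫ T ◁ c' ≫ (α_ _ _ _).inv) ≫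
        (e ⊗ₘ e') ▷ P := by
  rw [MonoidalCategory.tensorHom_def]
  calc
    _ = 𝟙 _ ⊗≫ P ◁ e ▷ T' ⊗≫ ((P ⊗ V) ◁ e' ≫ b ▷ V') ⊗≫ V ◁ b' ⊗≫ 𝟙 _ := by monoidal
    _ = 𝟙 _ ⊗≫ (P ◁ e ≫ b) ▷ T' ⊗≫ V ◁ (P ◁ e' ≫ b') ⊗≫ 𝟙 _ := by
      rw [whisker_exchange]; monoidal
    _ = 𝟙 _ ⊗≫ c ▷ T' ⊗≫ (e ▷ (P ⊗ T') ≫ V ◁ c') ⊗≫ V ◁ e' ▷ P ⊗≫ 𝟙 _ := by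
      rw [h, h']; monoidal
    _ = _ := by rw [← whisker_exchange]; monoidal

/-- A morphism `i : F(X) ⟶ K` is compatible with the half-braidings of `X` and `K`. -/
def CenterRelated (X : Center C) (K : Center D) (i : F.obj X.1 ⟶ K.1) : Prop :=
  ∀ U : C, i ▷ F.obj U ≫ (K.2.β (F.obj U)).hom =
    μ F X.1 U ≫ F.map (X.2.β U).hom ≫ δ F U X.1 ≫ F.obj U ◁ i

variable {F}

theorem CenterRelated.comp_map {X X' : Center C} {K : Center D} {i : F.obj X'.1 ⟶ K.1}
    (h : CenterRelated F X' K i) (f : X ⟶ X') : CenterRelated F X K (F.map f.f ≫ i) := by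
  intro U
  have h1 := congrArg F.map (f.comm U)
  rw [F.map_comp, F.map_comp] at h1
  rw [comp_whiskerRight, Category.assoc, h, whiskerLeft_comp, μ_natural_left_assoc,
    reassoc_of% h1, ← δ_natural_right_assoc]

/-- Compatibility with half-braidings need only be checked at objects `F(U)`, by naturality and
essential surjectivity; there both half-braidings come from that of `X`. -/
theorem CenterRelated.comm_of_fac [F.EssSurj] {X : Center C} {K K' : Center D}
    {i : F.obj X.1 ≅ K.1} (h : CenterRelated F X K i.hom) {j : F.obj X.1 ⟶ K'.1}
    (h' : CenterRelated F X K' j) {f : K.1 ⟶ K'.1} (hf : i.hom ≫ f = j) :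
    ∃ g : K ⟶ K', g.f = f := by
  refine ⟨⟨f, fun V => ?_⟩, rfl⟩
  let e := F.objObjPreimageIso V
  have h1 : f ▷ F.obj (F.objPreimage V) ≫ (K'.2.β _).hom =
      (K.2.β _).hom ≫ F.obj (F.objPreimage V) ◁ f := by
    rw [← cancel_epi (i.hom ▷ _), ← comp_whiskerRight_assoc, hf, h', reassoc_of% (h _), ← hf,
      whiskerLeft_comp]
  rw [← cancel_epi (K.1 ◁ e.hom), HalfBraiding.naturality_assoc, ← whisker_exchange,
    ← reassoc_of% h1, ← HalfBraiding.naturality, ← whisker_exchange_assoc]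

theorem exists_centerRelated_of_center [F.EssSurj] [F.Full] (X : Center C) :
    ∃ (K : Center D) (i : F.obj X.1 ≅ K.1), CenterRelated F X K i.hom := by
  let e (V : D) := F.objObjPreimageIso V
  let b (V : D) : F.obj X.1 ⊗ V ≅ V ⊗ F.obj X.1 :=
    whiskerLeftIso _ (e V).symm ≪≫ Functor.Monoidal.μIso F _ _ ≪≫ F.mapIso (X.2.β _) ≪≫
      (Functor.Monoidal.μIso F _ _).symm ≪≫ whiskerRightIso (e V) _
  -- Fullness shows that any `t : F(U) ⟶ V` may replace the chosen preimage of `V`; naturality and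
  -- the value at `F(U)` both follow.
  have hb : ∀ {U : C} {V : D} (t : F.obj U ⟶ V), F.obj X.1 ◁ t ≫ (b V).hom =
      μ F X.1 U ≫ F.map (X.2.β U).hom ≫ δ F U X.1 ≫ t ▷ F.obj X.1 := by
    intro U V t
    obtain ⟨t', ht'⟩ := F.map_surjective (t ≫ (e V).inv)
    have h1 := congrArg F.map (X.2.naturality t')
    rw [F.map_comp, F.map_comp] at h1
    obtain rfl : t = F.map t' ≫ (e V).hom := by rw [ht', Category.assoc, Iso.inv_hom_id,
      Category.comp_id]
    simp only [b, Iso.trans_hom, whiskerLeftIso_hom, Iso.symm_hom, Functor.Monoidal.μIso_hom,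
      Functor.mapIso_hom, Functor.Monoidal.μIso_inv, whiskerRightIso_hom]
    rw [← whiskerLeft_comp_assoc, Category.assoc, Iso.hom_inv_id, Category.comp_id,
      μ_natural_right_assoc, reassoc_of% h1, ← δ_natural_left_assoc, comp_whiskerRight]
  have hn : ∀ {V V' : D} (f : V ⟶ V'), F.obj X.1 ◁ f ≫ (b V').hom = (b V).hom ≫ f ▷ _ := by
    intro V V' f
    rw [← cancel_epi (F.obj X.1 ◁ (e V).hom), ← whiskerLeft_comp_assoc, hb, reassoc_of% hb,
      comp_whiskerRight]
  have hF : ∀ U : C, (b (F.obj U)).hom = μ F X.1 U ≫ F.map (X.2.β U).hom ≫ δ F U X.1 := by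
    intro U
    simpa using hb (𝟙 (F.obj U))
  have ht : ∀ V V' : D, (b (V ⊗ V')).hom = (α_ _ _ _).inv ≫ ((b V).hom ▷ V') ≫
      (α_ _ _ _).hom ≫ (V ◁ (b V').hom) ≫ (α_ _ _ _).inv := by
    have h1 : ∀ U U' : C, (b (F.obj U ⊗ F.obj U')).hom = (α_ _ _ _).inv ≫
        ((b (F.obj U)).hom ▷ F.obj U') ≫ (α_ _ _ _).hom ≫ (F.obj U ◁ (b (F.obj U')).hom) ≫
        (α_ _ _ _).inv := by
      intro U U'
      rw [← cancel_epi (F.obj X.1 ◁ δ F U U'), hb, hF, hF, X.2.monoidal,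
        reassoc_of% map_tensor_halfBraiding]
      simp only [← comp_whiskerRight, Functor.Monoidal.μ_δ, id_whiskerRight, Category.comp_id]
    intro V V'
    rw [← cancel_epi (F.obj X.1 ◁ ((e V).hom ⊗ₘ (e V').hom)), hn, h1]
    have h2 := hn (e V).hom
    have h3 := hn (e V').hom
    exact (tensor_halfBraiding_naturality h2 h3).symm
  exact ⟨⟨F.obj X.1, ⟨b, ht, hn⟩⟩, Iso.refl _, fun U => by
    simpa using hF U⟩

theorem exists_centerRelated_of_iso [F.Full] [F.Faithful] {X : C} (K : Center D)
    (i : F.obj X ≅ K.1) :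
    ∃ b : HalfBraiding X, CenterRelated F ⟨X, b⟩ K i.hom := by
  let b (U : C) : X ⊗ U ≅ U ⊗ X := F.preimageIso
    ((Functor.Monoidal.μIso F _ _).symm ≪≫ whiskerRightIso i _ ≪≫ K.2.β (F.obj U) ≪≫
      whiskerLeftIso _ i.symm ≪≫ Functor.Monoidal.μIso F _ _)
  have hb : ∀ U : C, F.map (b U).hom = δ F X U ≫ i.hom ▷ F.obj U ≫ (K.2.β (F.obj U)).hom ≫
      F.obj U ◁ i.inv ≫ μ F U X := by
    intro U
    simp [b]
  have hb' : ∀ U : C, μ F X U ≫ F.map (b U).hom ≫ δ F U X ≫ F.obj U ◁ i.hom =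
      i.hom ▷ F.obj U ≫ (K.2.β (F.obj U)).hom := by
    intro U
    simp only [hb, Category.assoc, Functor.Monoidal.μ_δ_assoc, ← whiskerLeft_comp,
      Iso.inv_hom_id, whiskerLeft_id, Category.comp_id]
  refine ⟨⟨b, fun U U' => F.map_injective ?_, fun {U U'} f => F.map_injective ?_⟩, fun U =>
    (hb' U).symm⟩
  · have h1 := K.2.naturality (μ F U U')
    rw [← cancel_mono (δ F (U ⊗ U') X), ← cancel_mono (F.obj (U ⊗ U') ◁ i.hom),
      ← cancel_epi (μ F X (U ⊗ U')), ← cancel_epi (F.obj X ◁ μ F U U'), Category.assoc,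
      Category.assoc, hb', whisker_exchange_assoc, h1,
      reassoc_of% map_tensor_halfBraiding]
    rw [← whiskerLeft_comp_assoc, Functor.Monoidal.μ_δ, whiskerLeft_id, Category.id_comp,
      ← whisker_exchange, K.2.monoidal]
    have h2 := hb' U
    have h3 := hb' U'
    calc
      _ = 𝟙 _ ⊗≫ (i.hom ▷ F.obj U ≫ (K.2.β (F.obj U)).hom) ▷ F.obj U' ⊗≫
          F.obj U ◁ (K.2.β (F.obj U')).hom ⊗≫ μ F U U' ▷ K.1 := by monoidal
      _ = 𝟙 _ ⊗≫ (μ F X U ≫ F.map (b U).hom ≫ δ F U X) ▷ F.obj U' ⊗≫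
          F.obj U ◁ (i.hom ▷ F.obj U' ≫ (K.2.β (F.obj U')).hom) ⊗≫ μ F U U' ▷ K.1 := by
        rw [← h2]; monoidal
      _ = _ := by rw [← h3]; monoidal
  · have h1 := K.2.naturality (F.map f)
    rw [← cancel_mono (δ F _ X), ← cancel_mono (_ ◁ i.hom), ← cancel_epi (μ F X _), F.map_comp,
      F.map_comp, Category.assoc, Category.assoc, Category.assoc, Category.assoc,
      ← μ_natural_right_assoc, hb', whisker_exchange_assoc, h1, ← δ_natural_left_assoc,
      ← whisker_exchange, reassoc_of% hb']

/-- Each test object `L` of the center of `D` is related to some `L'` in the center of `C`, and `F`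
matches lifts `L ⟶ K` with lifts `L' ⟶ X`. -/
theorem CenterRelated.isCofree [F.Full] [F.Faithful] [F.EssSurj] {X : Center C} {K : Center D}
    {i : F.obj X.1 ≅ K.1} (h : CenterRelated F X K i.hom) {W : C} {e : X.1 ⟶ W}
    (he : IsCofree X e) {W' : D} (w : F.obj W ≅ W') {e' : K.1 ⟶ W'}
    (he' : i.hom ≫ e' = F.map e ≫ w.hom) : IsCofree K e' := by
  intro L g
  obtain ⟨b, hb⟩ := exists_centerRelated_of_iso L (F.objObjPreimageIso L.1)
  set L' : Center C := ⟨_, b⟩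
  let j : F.obj L'.1 ≅ L.1 := F.objObjPreimageIso L.1
  replace hb : CenterRelated F L' L j.hom := hb
  obtain ⟨g', hg'⟩ := F.map_surjective (j.hom ≫ g ≫ w.inv)
  obtain ⟨t, ht, hu⟩ := he L' g'
  have key : ∀ (s : L' ⟶ X) (r : L ⟶ K), F.map s.f ≫ i.hom = j.hom ≫ r.f →
      (r.f ≫ e' = g ↔ s.f ≫ e = g') := by
    intro s r hsr
    rw [← F.map_injective.eq_iff, hg', ← cancel_epi j.hom, ← cancel_mono w.inv,
      ← reassoc_of% hsr, he', F.map_comp, ← Category.assoc (F.map s.f), Category.assoc _ w.hom,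
      Iso.hom_inv_id, Category.comp_id, Category.assoc]
  obtain ⟨r, hr⟩ := hb.comm_of_fac (h.comp_map t) (f := j.inv ≫ F.map t.f ≫ i.hom)
    (by rw [Iso.hom_inv_id_assoc])
  refine ⟨r, (key t r (by rw [hr, Iso.hom_inv_id_assoc])).2 ht, fun r' hr' => ?_⟩
  obtain ⟨s, hs⟩ := F.map_surjective (j.hom ≫ r'.f ≫ i.inv)
  have hs' : F.map s ≫ i.hom = j.hom ≫ r'.f := by
    rw [hs, Category.assoc, Category.assoc, Iso.inv_hom_id, Category.comp_id]
  -- Faithfulness reduces compatibility of `s` with half-braidings to that of `r'`.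
  have hs'' : ∃ s' : L' ⟶ X, s'.f = s := by
    refine ⟨⟨s, fun U => F.map_injective ?_⟩, rfl⟩
    have h1 := r'.comm (F.obj U)
    have h2 := hb U
    have h3 := h U
    rw [F.map_comp, F.map_comp, ← cancel_epi (μ F _ U), ← μ_natural_left_assoc,
      ← cancel_mono (δ F _ _), ← cancel_mono (_ ◁ i.hom), Category.assoc, Category.assoc,
      Category.assoc, Category.assoc, Category.assoc, Category.assoc, ← h3,
      ← comp_whiskerRight_assoc, hs', comp_whiskerRight, Category.assoc, h1,
      ← δ_natural_right_assoc, ← whiskerLeft_comp, hs', whiskerLeft_comp, ← reassoc_of% h2]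
  obtain ⟨s', rfl⟩ := hs''
  obtain rfl := hu s' ((key s' r' hs').1 hr')
  apply Center.ext
  rw [hr, hs', Iso.inv_hom_id_assoc]

end CenterRelated

/-! ### Compatibility of the transport with duals and units -/

section DualRelated
universe v u v' u'
open Functor.LaxMonoidal Functor.OplaxMonoidal
variable {C : Type u} [Category.{v} C] [MonoidalCategory C]
  {D : Type u'} [Category.{v'} D] [MonoidalCategory D]

theorem whiskerRight_evaluation_cancel {X Y U Z : C} [ExactPairing X Y] {a b : Z ⟶ U ⊗ Y}
    (h : a ▷ X ≫ (α_ _ _ _).hom ≫ U ◁ ε_ X Y = b ▷ X ≫ (α_ _ _ _).hom ≫ U ◁ ε_ X Y) : a = b := by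
  apply (tensorRightHomEquiv Z X Y U).symm.injective
  have h1 := congrArg (fun t => t ≫ (ρ_ U).hom) h
  simpa [tensorRightHomEquiv] using h1

theorem map_dualBraiding {F : C ⥤ D} [F.Monoidal] {X Y U : C} [ExactPairing X Y]
    (f : X ⊗ U ≅ U ⊗ X) (g : Y ⊗ U ⟶ U ⊗ Y)
    (h : g ▷ X ⊗≫ U ◁ ε_ X Y = 𝟙 _ ⊗≫ Y ◁ f.inv ⊗≫ ε_ X Y ▷ U ⊗≫ 𝟙 _) :
    (μ F Y U ≫ F.map g ≫ δ F U Y) ▷ F.obj X ≫ (α_ _ _ _).hom ≫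
      F.obj U ◁ (μ F Y X ≫ F.map (ε_ X Y) ≫ η F) =
    (α_ _ _ _).hom ≫ F.obj Y ◁ (μ F U X ≫ F.map f.inv ≫ δ F X U) ≫ (α_ _ _ _).inv ≫
      (μ F Y X ≫ F.map (ε_ X Y) ≫ η F) ▷ F.obj U ≫ (λ_ _).hom ≫ (ρ_ _).inv := by
  have h1 : g ▷ X ≫ (α_ _ _ _).hom ≫ U ◁ ε_ X Y ≫ (ρ_ U).hom =
      (α_ _ _ _).hom ≫ Y ◁ f.inv ≫ (α_ _ _ _).inv ≫ ε_ X Y ▷ U ≫ (λ_ U).hom := by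
    have := congrArg (fun t => t ≫ (ρ_ U).hom) h
    refine Eq.trans ?_ (this.trans ?_) <;> monoidal
  have h2 := congrArg F.map h1
  simp only [Functor.map_comp, Functor.Monoidal.map_associator,
    Functor.Monoidal.map_associator_inv, Functor.Monoidal.map_whiskerLeft,
    Functor.Monoidal.map_whiskerRight, Functor.Monoidal.map_leftUnitor,
    Functor.Monoidal.map_rightUnitor, Category.assoc, Functor.Monoidal.μ_δ_assoc] at h2
  rw [← cancel_epi (δ F Y U ▷ F.obj X), ← cancel_epi (δ F (Y ⊗ U) X), ← cancel_mono (ρ_ _).hom]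
  simp only [comp_whiskerRight, whiskerLeft_comp, Category.assoc, Iso.inv_hom_id,
    Category.comp_id]
  rw [← comp_whiskerRight_assoc, Functor.Monoidal.δ_μ, id_whiskerRight, Category.id_comp, h2]

variable [RigidCategory C] [RigidCategory D] {F : C ⥤ D} [F.Monoidal]

/-- Morphisms into `F(U) ⊗ K^*` are determined by their pairing with `K`. Under this pairing a dual
half-braiding becomes the inverse of the original one, and `hev` and `hi` express the evaluation and
that inverse through `F`. -/
theorem dualBraidingHom_centerRelated {X : Center C} {K : Center D} {i : F.obj X.1 ≅ K.1}
    (h : CenterRelated F X K i.hom) :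
    CenterRelated F (dual X) (dual K) ((dualityIso F X.1).hom ≫ dualMap i.inv) := by
  set j : F.obj (dual X.1) ⟶ dual K.1 := (dualityIso F X.1).hom ≫ dualMap i.inv with hj
  have hev : j ▷ K.1 ≫ ev K.1 =
      F.obj (dual X.1) ◁ i.inv ≫ μ F (dual X.1) X.1 ≫ F.map (ev X.1) ≫ η F := by
    rw [hj, comp_whiskerRight, Category.assoc, rightAdjointMate_comp_evaluation,
      ← whisker_exchange_assoc, dualityIso_hom_evaluation]
  intro U
  have hi : (K.2.β (F.obj U)).inv = F.obj U ◁ i.inv ≫ μ F U X.1 ≫ F.map (X.2.β U).inv ≫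
      δ F X.1 U ≫ i.hom ▷ F.obj U := by
    rw [← cancel_mono (K.2.β (F.obj U)).hom, Iso.inv_hom_id]
    simp only [Category.assoc, h U, Functor.Monoidal.δ_μ_assoc, ← F.map_comp_assoc,
      Iso.inv_hom_id, F.map_id, Category.id_comp, Functor.Monoidal.μ_δ_assoc,
      ← whiskerLeft_comp, whiskerLeft_id]
  have hD := dualBraidingHom_evaluation K.2 (dual K.1) (F.obj U)
  have hC := map_dualBraiding (F := F) (X.2.β U) _ (dualBraidingHom_evaluation X.2 (dual X.1) U)
  change j ▷ F.obj U ≫ dualBraidingHom K.2 (dual K.1) (F.obj U) =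
    μ F (dual X.1) U ≫ F.map (dualBraidingHom X.2 (dual X.1) U) ≫ δ F U (dual X.1) ≫ F.obj U ◁ j
  apply whiskerRight_evaluation_cancel (X := K.1)
  set A := dualBraidingHom K.2 (dual K.1) (F.obj U)
  set N := μ F (dual X.1) X.1 ≫ F.map (ev X.1) ≫ η F
  set M := μ F U X.1 ≫ F.map (X.2.β U).inv ≫ δ F X.1 U
  have hM : (K.2.β (F.obj U)).inv ≫ i.inv ▷ F.obj U = F.obj U ◁ i.inv ≫ M := by
    rw [hi]
    simp only [M, Category.assoc, ← comp_whiskerRight, Iso.hom_inv_id, id_whiskerRight,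
      Category.comp_id]
  calc
    _ = 𝟙 _ ⊗≫ j ▷ F.obj U ▷ K.1 ⊗≫ (A ▷ K.1 ⊗≫ F.obj U ◁ ev K.1) := by monoidal
    _ = 𝟙 _ ⊗≫ (j ▷ (F.obj U ⊗ K.1) ≫ dual K.1 ◁ (K.2.β (F.obj U)).inv) ⊗≫
        ev K.1 ▷ F.obj U ⊗≫ 𝟙 _ := by rw [hD]; monoidal
    _ = 𝟙 _ ⊗≫ F.obj (dual X.1) ◁ (K.2.β (F.obj U)).inv ⊗≫ (j ▷ K.1 ≫ ev K.1) ▷ F.obj U ⊗≫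
        𝟙 _ := by rw [← whisker_exchange]; monoidal
    _ = 𝟙 _ ⊗≫ F.obj (dual X.1) ◁ ((K.2.β (F.obj U)).inv ≫ i.inv ▷ F.obj U) ⊗≫
        N ▷ F.obj U ⊗≫ 𝟙 _ := by rw [hev]; monoidal
    _ = (F.obj (dual X.1) ⊗ F.obj U) ◁ i.inv ≫ ((α_ _ _ _).hom ≫ F.obj (dual X.1) ◁ M ≫
        (α_ _ _ _).inv ≫ N ▷ F.obj U ≫ (λ_ _).hom ≫ (ρ_ _).inv) := by rw [hM]; monoidal
    _ = _ := by
      rw [← hC, whisker_exchange_assoc]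
      have hB : μ F (dual X.1) U ≫ F.map (dualBraidingHom X.2 (dual X.1) U) ≫
          δ F U (dual X.1) ≫ F.obj U ◁ j = (μ F (dual X.1) U ≫
          F.map (dualBraidingHom X.2 (dual X.1) U) ≫ δ F U (dual X.1)) ≫ F.obj U ◁ j := by
        simp only [Category.assoc]
      rw [hB]
      generalize μ F (dual X.1) U ≫ F.map (dualBraidingHom X.2 (dual X.1) U) ≫
        δ F U (dual X.1) = B
      calc
        _ = B ▷ K.1 ≫ (α_ _ _ _).hom ≫ F.obj U ◁ (F.obj (dual X.1) ◁ i.inv ≫ N) := by monoidal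
        _ = _ := by rw [← hev]; monoidal

/-- The isomorphism `F(X)^{**} ≅ K^{**}` composed with `ξ_X` is compatible with the half-braidings
of `X^{**}` and `K^{**}`. -/
theorem CenterRelated.doubleDual {X : Center C} {K : Center D} {i : F.obj X.1 ≅ K.1}
    (h : CenterRelated F X K i.hom) :
    CenterRelated F (dual (dual X)) (dual (dual K))
      ((doubleDualityIso F X.1).hom ≫ dualMap (dualMap i.hom)) := by
  have h1 : CenterRelated F (dual X) (dual K) (dualityIso F X.1 ≪≫ dualIso i).hom :=
    dualBraidingHom_centerRelated h
  have h2 := dualBraidingHom_centerRelated h1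
  convert h2 using 1
  exact (Category.assoc _ _ _).trans
    (congrArg (fun t => (dualityIso F (dual X.1)).hom ≫ t) (dualMap_comp _ _).symm)

omit [RigidCategory D] in
theorem dualMap_comp_ev {X Y : C} (f : X ⟶ Y) : dualMap f ▷ X ≫ ev X = dual Y ◁ f ≫ ev Y :=
  rightAdjointMate_comp_evaluation f

omit [RigidCategory D] in
theorem unitDualIso_hom_evaluation :
    (unitDualIso (C := C)).hom ▷ 𝟙_ C ≫ ev (𝟙_ C) = (λ_ (𝟙_ C)).hom := by
  have h := @rightAdjointMate_comp_evaluation C _ _ (𝟙_ C) (𝟙_ C)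
    (@HasRightDual.mk C _ _ _ (dual (𝟙_ C)) (dualPairing (𝟙_ C)))
    (@HasRightDual.mk C _ _ _ (𝟙_ C) exactPairingUnit) (𝟙 (𝟙_ C))
  rw [MonoidalCategory.whiskerLeft_id, Category.id_comp] at h
  refine h.trans ?_
  change (ρ_ _).hom = _
  monoidal

theorem map_unitDualIso (F : C ⥤ D) [F.Monoidal] :
    F.map (unitDualIso (C := C)).hom ≫ (dualityIso F (𝟙_ C)).hom ≫ dualMap (ε F) =
      η F ≫ (unitDualIso (C := D)).hom := by
  apply evaluation_cancel (dualPairing (𝟙_ D))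
  change _ ≫ ev (𝟙_ D) = _ ≫ ev (𝟙_ D)
  have h := congrArg F.map (unitDualIso_hom_evaluation (C := C))
  rw [F.map_comp] at h
  rw [comp_whiskerRight, comp_whiskerRight, Category.assoc, Category.assoc,
    dualMap_comp_ev, ← whisker_exchange_assoc, dualityIso_hom_evaluation,
    ← whisker_exchange_assoc, μ_natural_left_assoc, reassoc_of% h, comp_whiskerRight,
    Category.assoc, unitDualIso_hom_evaluation, Functor.Monoidal.map_leftUnitor]
  simp [unitors_equal]

/-- This is the statement that `F^piv` preserves the pivotal unit; it serves both the counit of the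
transported cofree object and the case `n = 1` of the indicators. -/
theorem map_unitDoubleDualIso (F : C ⥤ D) [F.Monoidal] :
    F.map (unitDoubleDualIso (C := C)).hom ≫ (doubleDualityIso F (𝟙_ C)).hom ≫
      dualMap (dualMap (η F)) = η F ≫ (unitDoubleDualIso (C := D)).hom := by
  let u := unitDualIso (C := C)
  let u' := unitDualIso (C := D)
  let z := dualityIso F (𝟙_ C)
  let i := (Functor.Monoidal.εIso F).symm
  have h : F.mapIso u ≪≫ z ≪≫ dualIso i = i ≪≫ u' := Iso.ext (map_unitDualIso F)
  have h1 : F.map u.hom ≫ z.hom ≫ dualMap i.inv = i.hom ≫ u'.hom := map_unitDualIso F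
  have h2 : dualMap i.hom ≫ z.inv ≫ F.map u.inv = u'.inv ≫ i.inv := by
    change (dualIso i).inv ≫ _ = _
    simpa using congrArg Iso.inv h
  have h3 := dualityIso_naturality F u.inv
  change F.map (u.hom ≫ dualMap u.inv) ≫ ((dualityIso F (dual (𝟙_ C))).hom ≫ dualMap z.inv) ≫
    dualMap (dualMap i.hom) = i.hom ≫ u'.hom ≫ dualMap u'.inv
  rw [F.map_comp, Category.assoc, Category.assoc, reassoc_of% h3, ← dualMap_comp, ← dualMap_comp,
    Category.assoc, h2, dualMap_comp, reassoc_of% h1]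

theorem unitDoubleDualIso_hom_comp (F : C ⥤ D) [F.Monoidal] :
    unitDoubleDualIso.hom ≫ dualMap (dualMap (ε F)) =
      ε F ≫ F.map unitDoubleDualIso.hom ≫ (doubleDualityIso F (𝟙_ C)).hom := by
  have h1 : dualMap (dualMap (η F)) ≫ dualMap (dualMap (ε F)) = 𝟙 _ := by
    rw [← dualMap_comp, ← dualMap_comp, Functor.Monoidal.η_ε, dualMap_id, dualMap_id]
  have h2 := congrArg (fun t => ε F ≫ t ≫ dualMap (dualMap (ε F))) (map_unitDoubleDualIso F)
  simp only [Category.assoc, h1, Category.comp_id, Functor.Monoidal.ε_η_assoc] at h2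
  exact h2.symm

end DualRelated

/-! ### Traces of powers of conjugate operators -/

section Trace
variable {k : Type*} [Field k] {M N : Type*} [AddCommGroup M] [Module k M] [AddCommGroup N]
  [Module k N]

theorem trace_zpow_eq_of_semiconj (T : M ≃ₗ[k] N) (E : M ≃ₗ[k] M) (E' : N ≃ₗ[k] N)
    (h : ∀ x, T (E x) = E' (T x)) (r : ℤ) :
    LinearMap.trace k M (E ^ r).toLinearMap = LinearMap.trace k N (E' ^ r).toLinearMap := by
  have hn : ∀ (n : ℕ) (x : M), T ((E ^ n) x) = (E' ^ n) (T x) := by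
    intro n
    induction n with
    | zero => intro x; rfl
    | succ n ih =>
      intro x
      rw [pow_succ', pow_succ']
      exact (h _).trans (congrArg E' (ih x))
  have hz : ∀ x : M, T ((E ^ r) x) = (E' ^ r) (T x) := by
    intro x
    cases r with
    | ofNat n => simpa using hn n x
    | negSucc n =>
      rw [zpow_negSucc, zpow_negSucc]
      refine ((E' ^ (n + 1)).symm_apply_eq.2 ?_).symm
      rw [← hn]
      exact congrArg T ((E ^ (n + 1)).apply_symm_apply x).symm
  rw [← LinearMap.trace_conj' _ T]
  congr 1
  ext y
  rw [LinearEquiv.conj_apply_apply]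
  exact (hz _).trans (congrArg _ (T.apply_symm_apply y))

theorem trace_pow_eq_of_semiconj (T : M ≃ₗ[k] N) (E : M →ₗ[k] M) (E' : N →ₗ[k] N)
    (h : ∀ x, T (E x) = E' (T x)) (n : ℕ) :
    LinearMap.trace k M (E ^ n) = LinearMap.trace k N (E' ^ n) := by
  have hn : ∀ x : M, T ((E ^ n) x) = (E' ^ n) (T x) := by
    induction n with
    | zero => intro x; rfl
    | succ n ih =>
      intro x
      rw [pow_succ', pow_succ']
      exact (h _).trans (congrArg E' (ih x))
  rw [← LinearMap.trace_conj' _ T]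
  congr 1
  ext y
  rw [LinearEquiv.conj_apply_apply, hn, T.apply_symm_apply]

end Trace

/-! ### Evaluation, coevaluation and pivotal dimension under a monoidal functor -/

section PivotalRelated
universe v u v' u'
open Functor.LaxMonoidal Functor.OplaxMonoidal
variable {C : Type u} [Category.{v} C] [MonoidalCategory C] [RigidCategory C]
  {D : Type u'} [Category.{v'} D] [MonoidalCategory D] [RigidCategory D]

/-- An isomorphism `θ : F(V) ≅ W` underlying an isomorphism of the pivotal objects `F^piv(V)`
and `W`. -/
def PivotalRelated (F : C ⥤ D) [F.Monoidal] (V : PivotalCover C) (W : PivotalCover D)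
    (θ : F.obj V.obj ≅ W.obj) : Prop :=
  F.map V.φ.hom ≫ (doubleDualityIso F V.obj).hom ≫ dualMap (dualMap θ.hom) = θ.hom ≫ W.φ.hom

/-- The isomorphism `F(X^*) ≅ Y^*` induced by an isomorphism `F(X) ≅ Y`. -/
noncomputable def mapDualIso (F : C ⥤ D) [F.Monoidal] {X : C} {Y : D} (θ : F.obj X ≅ Y) :
    F.obj (dual X) ≅ dual Y :=
  dualityIso F X ≪≫ dualIso θ

variable {F : C ⥤ D} [F.Monoidal]

theorem mapDualIso_mapDualIso_hom {X : C} {Y : D} (θ : F.obj X ≅ Y) :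
    (mapDualIso F (mapDualIso F θ)).hom =
      (doubleDualityIso F X).hom ≫ dualMap (dualMap θ.hom) := by
  simp only [mapDualIso, doubleDualityIso, dualIso, Iso.trans_hom, Iso.trans_inv, dualMap_comp,
    Category.assoc]

theorem coev_eq_map_coev {X : C} {Y : D} (θ : F.obj X ≅ Y) :
    coev Y = ε F ≫ F.map (coev X) ≫ δ F X (dual X) ≫ (θ.hom ⊗ₘ (mapDualIso F θ).hom) := by
  have h1 := @coevaluation_comp_rightAdjointMate D _ _ (F.obj X) (F.obj X)
    (@HasRightDual.mk D _ _ _ (dual (F.obj X)) (dualPairing (F.obj X)))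
    (@HasRightDual.mk D _ _ _ (F.obj (dual X)) (mapPairing F X (dual X))) (𝟙 (F.obj X))
  have h2 : (ε F ≫ F.map (coev X) ≫ δ F X (dual X)) ≫ F.obj X ◁ (dualityIso F X).hom =
      coev (F.obj X) ≫ 𝟙 (F.obj X) ▷ dual (F.obj X) := h1
  have h3 : coev (F.obj X) ≫ F.obj X ◁ dualMap θ.inv = coev Y ≫ θ.inv ▷ dual Y :=
    coevaluation_comp_rightAdjointMate θ.inv
  rw [id_whiskerRight, Category.comp_id, Category.assoc, Category.assoc] at h2
  rw [← cancel_mono (θ.inv ▷ dual Y), ← h3, ← h2]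
  simp only [mapDualIso, dualIso, Iso.trans_hom, MonoidalCategory.tensorHom_def', Category.assoc,
    whiskerLeft_comp, ← comp_whiskerRight, Iso.hom_inv_id, id_whiskerRight, Category.comp_id]

theorem tensorHom_mapDualIso_ev {X : C} {Y : D} (θ : F.obj X ≅ Y) :
    ((mapDualIso F θ).hom ⊗ₘ θ.hom) ≫ ev Y = μ F (dual X) X ≫ F.map (ev X) ≫ η F := by
  rw [← dualityIso_hom_evaluation, MonoidalCategory.tensorHom_def, Category.assoc,
    ← dualMap_comp_ev, ← comp_whiskerRight_assoc]
  simp only [mapDualIso, dualIso, Iso.trans_hom, Category.assoc, ← dualMap_comp, Iso.hom_inv_id,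
    dualMap_id, Category.comp_id]

theorem PivotalRelated.map_inv_comp {V : PivotalCover C} {W : PivotalCover D}
    {θ : F.obj V.obj ≅ W.obj} (h : PivotalRelated F V W θ) :
    (mapDualIso F (mapDualIso F θ)).hom ≫ W.φ.inv = F.map V.φ.inv ≫ θ.hom := by
  rw [mapDualIso_mapDualIso_hom, Iso.comp_inv_eq, Category.assoc, ← h, ← F.map_comp_assoc,
    Iso.inv_hom_id, F.map_id, Category.id_comp]

/-- Needed because indicators with `n < 0`, or with `n = 0` and `r < 0`, are defined through the
dual. -/
theorem PivotalRelated.dualObj {V : PivotalCover C} {W : PivotalCover D}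
    {θ : F.obj V.obj ≅ W.obj} (h : PivotalRelated F V W θ) :
    PivotalRelated F V.dualObj W.dualObj (mapDualIso F θ) := by
  have h1 := dualityIso_naturality F V.φ.inv
  have h2 : dualMap (mapDualIso F θ).hom ≫ (dualityIso F (dual V.obj)).inv ≫ F.map V.φ.inv =
      W.φ.inv ≫ θ.inv := by
    have h3 := h.map_inv_comp
    have h4 : (mapDualIso F (mapDualIso F θ)).hom =
      (dualityIso F (dual V.obj)).hom ≫ dualMap (mapDualIso F θ).inv := rfl
    rw [Iso.eq_comp_inv, Category.assoc, Category.assoc, ← h3, h4, Category.assoc,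
      Iso.inv_hom_id_assoc, ← Category.assoc, ← dualMap_comp, Iso.inv_hom_id, dualMap_id,
      Category.id_comp]
  have h5 : (mapDualIso F (mapDualIso F (mapDualIso F θ))).hom =
    (dualityIso F (dual (dual V.obj))).hom ≫
      dualMap (dualMap (mapDualIso F θ).hom ≫ (dualityIso F (dual V.obj)).inv) := rfl
  refine (congrArg (fun t => F.map (dualMap V.φ.inv) ≫ t)
    (mapDualIso_mapDualIso_hom (mapDualIso F θ)).symm).trans ?_
  rw [h5]
  change F.map (dualMap V.φ.inv) ≫ _ = ((dualityIso F V.obj).hom ≫ dualMap θ.inv) ≫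
    dualMap W.φ.inv
  rw [reassoc_of% h1, ← dualMap_comp, Category.assoc, Category.assoc, h2, dualMap_comp]

theorem PivotalRelated.map_leftDim {V : PivotalCover C} {W : PivotalCover D}
    {θ : F.obj V.obj ≅ W.obj} (h : PivotalRelated F V W θ) :
    leftDim W = ε F ≫ F.map (leftDim V) ≫ η F := by
  have h1 := coev_eq_map_coev (mapDualIso F θ)
  have h2 : ((mapDualIso F θ).hom ⊗ₘ (mapDualIso F (mapDualIso F θ)).hom) ≫
      dual W.obj ◁ W.φ.inv = F.obj (dual V.obj) ◁ F.map V.φ.inv ≫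
        ((mapDualIso F θ).hom ⊗ₘ θ.hom) := by
    simp only [← id_tensorHom, MonoidalCategory.tensorHom_comp_tensorHom, h.map_inv_comp,
      Category.id_comp, Category.comp_id]
  simp only [leftDim]
  rw [h1, Category.assoc, Category.assoc, Category.assoc, reassoc_of% h2,
    tensorHom_mapDualIso_ev, F.map_comp, F.map_comp, Category.assoc, Category.assoc,
    δ_natural_right_assoc, Functor.Monoidal.δ_μ_assoc]

/-- The isomorphism `F(V^{⊗ (m+1)}) ≅ W^{⊗ (m+1)}` induced by an isomorphism `F(V) ≅ W`. -/
noncomputable def mapTensorPowIso {V : C} {W : D} (θ : F.obj V ≅ W) :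
    ∀ m : ℕ, F.obj (tensorPow V m) ≅ tensorPow W m
  | 0 => θ
  | m + 1 => (Functor.Monoidal.μIso F V (tensorPow V m)).symm ≪≫ (θ ⊗ᵢ mapTensorPowIso θ m)

omit [RigidCategory C] [RigidCategory D] in
theorem map_tensorPowIso {V : C} {W : D} (θ : F.obj V ≅ W) (m : ℕ) :
    F.map (tensorPowIso V m).hom ≫ (mapTensorPowIso θ (m + 1)).hom =
      δ F (tensorPow V m) V ≫ ((mapTensorPowIso θ m).hom ⊗ₘ θ.hom) ≫
        (tensorPowIso W m).hom := by
  induction m with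
  | zero =>
    change F.map (𝟙 _) ≫ δ F V V ≫ (θ.hom ⊗ₘ θ.hom) = δ F V V ≫ (θ.hom ⊗ₘ θ.hom) ≫ 𝟙 _
    simp
  | succ m ih =>
    change F.map ((α_ _ _ _).hom ≫ V ◁ (tensorPowIso V m).hom) ≫
      δ F V (tensorPow V (m + 1)) ≫ (θ.hom ⊗ₘ (mapTensorPowIso θ (m + 1)).hom) =
      δ F (V ⊗ tensorPow V m) V ≫ ((δ F V (tensorPow V m) ≫
        (θ.hom ⊗ₘ (mapTensorPowIso θ m).hom)) ⊗ₘ θ.hom) ≫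
        (α_ _ _ _).hom ≫ W ◁ (tensorPowIso W m).hom
    have h1 : F.obj V ◁ F.map (tensorPowIso V m).hom ≫
        (θ.hom ⊗ₘ (mapTensorPowIso θ (m + 1)).hom) = F.obj V ◁ δ F (tensorPow V m) V ≫
        (θ.hom ⊗ₘ ((mapTensorPowIso θ m).hom ⊗ₘ θ.hom)) ≫ W ◁ (tensorPowIso W m).hom := by
      simp only [← id_tensorHom, MonoidalCategory.tensorHom_comp_tensorHom, ih,
        Category.id_comp, Category.comp_id]
    have h2 : (δ F V (tensorPow V m) ≫ (θ.hom ⊗ₘ (mapTensorPowIso θ m).hom)) ⊗ₘ θ.hom =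
        δ F V (tensorPow V m) ▷ F.obj V ≫ ((θ.hom ⊗ₘ (mapTensorPowIso θ m).hom) ⊗ₘ θ.hom) := by
      simp only [← tensorHom_id, MonoidalCategory.tensorHom_comp_tensorHom, Category.id_comp]
    rw [F.map_comp, Category.assoc, ← δ_natural_right_assoc, h1, h2, Category.assoc,
      MonoidalCategory.associator_naturality_assoc, Functor.OplaxMonoidal.associativity_assoc]

end PivotalRelated

/-! ### Invariance of rotation and of the indicators -/

section Rotation
universe v u v' u'
open Functor.LaxMonoidal Functor.OplaxMonoidal
variable {k : Type*} [Field k] {C : Type u} [Category.{v} C] [MonoidalCategory C]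
  [RigidCategory C] [Preadditive C] [Linear k C] [MonoidalPreadditive C] [MonoidalLinear k C]

variable (k) in
-- Both transpositions are undone by zigzags: the intermediate morphism `V^* ⟶ W` is `g` itself. As
-- every `f` has this form, rotation is reduced to coevaluations, which `F` preserves.
theorem rotateEquiv_coev_comp {V W : C} (g : dual V ⟶ W) :
    rotateEquiv k V W (coev V ≫ V ◁ g) = coev (dual V) ≫ g ▷ dual (dual V) := by
  change tensorRightHomEquiv (𝟙_ C) (dual V) (dual (dual V)) W
    (((ρ_ (dual V) ≪≫ (λ_ (dual V)).symm).inv ≫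
      (tensorLeftHomEquiv (𝟙_ C) V (dual V) W).symm (coev V ≫ V ◁ g)) ≫ 𝟙 W) = _
  rw [← Equiv.eq_symm_apply, tensorLeftHomEquiv_symm_coevaluation_comp_whiskerLeft,
    tensorRightHomEquiv_symm_coevaluation_comp_whiskerRight]
  simp

omit [Preadditive C] [MonoidalPreadditive C] in
theorem exists_eq_coev_comp {V W : C} (f : 𝟙_ C ⟶ V ⊗ W) :
    ∃ g : dual V ⟶ W, f = coev V ≫ V ◁ g := by
  refine ⟨(ρ_ _).inv ≫ (tensorLeftHomEquiv (𝟙_ C) V (dual V) W).symm f, ?_⟩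
  apply (tensorLeftHomEquiv (𝟙_ C) V (dual V) W).symm.injective
  rw [tensorLeftHomEquiv_symm_coevaluation_comp_whiskerLeft, Iso.hom_inv_id_assoc]

variable {D : Type u'} [Category.{v'} D] [MonoidalCategory D]
  [RigidCategory D] [Preadditive D] [Linear k D] [MonoidalPreadditive D] [MonoidalLinear k D]
  {F : C ⥤ D} [F.Monoidal]

variable (k) in
theorem rotateEquiv_map {V B : C} {W B' : D} (θ : F.obj V ≅ W) (b : F.obj B ⟶ B')
    (f : 𝟙_ C ⟶ V ⊗ B) :
    rotateEquiv k W B' (ε F ≫ F.map f ≫ δ F V B ≫ (θ.hom ⊗ₘ b)) =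
      ε F ≫ F.map (rotateEquiv k V B f) ≫ δ F B (dual (dual V)) ≫
        (b ⊗ₘ (mapDualIso F (mapDualIso F θ)).hom) := by
  obtain ⟨g, rfl⟩ := exists_eq_coev_comp f
  have h1 : ε F ≫ F.map (coev V ≫ V ◁ g) ≫ δ F V B ≫ (θ.hom ⊗ₘ b) =
      coev W ≫ W ◁ ((mapDualIso F θ).inv ≫ F.map g ≫ b) := by
    rw [coev_eq_map_coev θ, F.map_comp, Category.assoc, Category.assoc, Category.assoc,
      Category.assoc, ← δ_natural_right_assoc]
    simp only [← id_tensorHom, MonoidalCategory.tensorHom_comp_tensorHom, Iso.hom_inv_id_assoc,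
      Category.id_comp, Category.comp_id]
  rw [h1, rotateEquiv_coev_comp, rotateEquiv_coev_comp, coev_eq_map_coev (mapDualIso F θ),
    F.map_comp, Category.assoc, Category.assoc, Category.assoc, Category.assoc,
    ← δ_natural_left_assoc]
  simp only [← tensorHom_id, MonoidalCategory.tensorHom_comp_tensorHom, Iso.hom_inv_id_assoc,
    Category.id_comp, Category.comp_id]

/-- The linear bijection `Hom(𝟙, X) ≃ Hom(𝟙, Y)` induced by an isomorphism `F(X) ≅ Y`, for a fully
faithful linear monoidal functor `F`. -/
noncomputable def homUnitEquiv (k : Type*) [Field k] [Linear k C] [Linear k D]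
    [F.Full] [F.Faithful] [F.Additive] [F.Linear k] {X : C} {Y : D} (θ : F.obj X ≅ Y) :
    (𝟙_ C ⟶ X) ≃ₗ[k] (𝟙_ D ⟶ Y) :=
  LinearEquiv.ofBijective
    { toFun := fun f => ε F ≫ F.map f ≫ θ.hom
      map_add' := fun f g => by simp
      map_smul' := fun c f => by simp }
    ⟨fun f g h => F.map_injective (by
        have h' : ε F ≫ F.map f ≫ θ.hom = ε F ≫ F.map g ≫ θ.hom := h
        rwa [cancel_epi, cancel_mono] at h'),
      fun g => by
        obtain ⟨f, hf⟩ := F.map_surjective (η F ≫ g ≫ θ.inv)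
        exact ⟨f, by simp [hf]⟩⟩

omit [Preadditive C] [MonoidalPreadditive C] [Preadditive D] [MonoidalPreadditive D] in
theorem PivotalRelated.map_transpose {V : PivotalCover C} {W : PivotalCover D}
    {θ : F.obj V.obj ≅ W.obj} (h : PivotalRelated F V W θ) (f : 𝟙_ C ⟶ V.obj) :
    ε F ≫ F.map ((unitDoubleDualIso.hom ≫ dualMap (dualMap f)) ≫ V.φ.inv) ≫ θ.hom =
      (unitDoubleDualIso.hom ≫ dualMap (dualMap (ε F ≫ F.map f ≫ θ.hom))) ≫ W.φ.inv := by
  have h2 := h.map_inv_comp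
  have h3 := doubleDualityIso_naturality F f
  rw [mapDualIso_mapDualIso_hom, Category.assoc] at h2
  simp only [F.map_comp, dualMap_comp, Category.assoc]
  rw [← h2, reassoc_of% (unitDoubleDualIso_hom_comp F), reassoc_of% h3]

variable (k) in
theorem PivotalRelated.map_rotate {V : PivotalCover C} {W : PivotalCover D}
    {θ : F.obj V.obj ≅ W.obj} (h : PivotalRelated F V W θ) (m : ℕ)
    (f : 𝟙_ C ⟶ V.obj ⊗ tensorPow V.obj m) :
    ε F ≫ F.map ((𝟙 _ ≫ rotateEquiv k V.obj (tensorPow V.obj m) f) ≫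
      tensorPow V.obj m ◁ V.φ.inv ≫ (tensorPowIso V.obj m).hom) ≫
        (mapTensorPowIso θ (m + 1)).hom =
      (𝟙 _ ≫ rotateEquiv k W.obj (tensorPow W.obj m) (ε F ≫ F.map f ≫
        (δ F V.obj (tensorPow V.obj m) ≫ (θ.hom ⊗ₘ (mapTensorPowIso θ m).hom)))) ≫
        tensorPow W.obj m ◁ W.φ.inv ≫ (tensorPowIso W.obj m).hom := by
  rw [rotateEquiv_map, Category.id_comp, Category.id_comp, F.map_comp, F.map_comp,
    Category.assoc, Category.assoc, map_tensorPowIso, ← δ_natural_right_assoc]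
  simp only [Category.assoc, ← id_tensorHom, MonoidalCategory.tensorHom_comp_tensorHom_assoc,
    h.map_inv_comp, Category.id_comp, Category.comp_id]

variable [F.Full] [F.Faithful] [F.Additive] [F.Linear k]

theorem PivotalRelated.homUnitEquiv_E {V : PivotalCover C} {W : PivotalCover D}
    {θ : F.obj V.obj ≅ W.obj} (h : PivotalRelated F V W θ) (m : ℕ) (f : 𝟙_ C ⟶ tensorPow V.obj m) :
    homUnitEquiv k (mapTensorPowIso θ m) (E k V m f) =
      E k W m (homUnitEquiv k (mapTensorPowIso θ m) f) := by
  cases m with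
  | zero => exact h.map_transpose f
  | succ m => exact h.map_rotate k m f

omit [MonoidalPreadditive C] [MonoidalLinear k C] [MonoidalPreadditive D]
  [MonoidalLinear k D] in
theorem PivotalRelated.homUnitEquiv_E₀ {V : PivotalCover C} {W : PivotalCover D}
    {θ : F.obj V.obj ≅ W.obj} (h : PivotalRelated F V W θ) (f : 𝟙_ C ⟶ 𝟙_ C) :
    homUnitEquiv k (Functor.Monoidal.εIso F).symm (E₀ k V f) =
      E₀ k W (homUnitEquiv k (Functor.Monoidal.εIso F).symm f) := by
  change ε F ≫ F.map (f ≫ leftDim V) ≫ η F = (ε F ≫ F.map f ≫ η F) ≫ leftDim W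
  rw [h.map_leftDim]
  simp

/-- The indicators are preserved by linear monoidal equivalences. -/
theorem PivotalRelated.indicator_eq {V : PivotalCover C} {W : PivotalCover D}
    {θ : F.obj V.obj ≅ W.obj} (h : PivotalRelated F V W θ) (n r : ℤ) :
    indicator k V n r = indicator k W n r := by
  match n, r with
  | Int.ofNat (m + 1), r => exact trace_zpow_eq_of_semiconj _ _ _ (h.homUnitEquiv_E m) r
  | Int.ofNat 0, Int.ofNat s => exact trace_pow_eq_of_semiconj _ _ _ h.homUnitEquiv_E₀ s
  | Int.ofNat 0, Int.negSucc s =>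
    exact trace_pow_eq_of_semiconj _ _ _ h.dualObj.homUnitEquiv_E₀ (s + 1)
  | Int.negSucc m, r => exact trace_zpow_eq_of_semiconj _ _ _ (h.dualObj.homUnitEquiv_E m) (-r)

end Rotation

/-! ### Transport of the adjoint object -/

section Invariance
universe v u v' u'
open Functor.LaxMonoidal Functor.OplaxMonoidal
variable {C : Type u} [Category.{v} C] [MonoidalCategory C] [RigidCategory C]
  {D : Type u'} [Category.{v'} D] [MonoidalCategory D] [RigidCategory D]

/-- The pivotal structure of an object of the center of `C` transported to the center of `D`. -/
theorem exists_pivotal_centerRelated (F : C ⥤ D) [F.Monoidal] [F.EssSurj] [F.Full]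
    (X : PivotalCover (Center C)) :
    ∃ (K : PivotalCover (Center D)) (i : F.obj X.obj.1 ≅ K.obj.1),
      CenterRelated F X.obj K.obj i.hom ∧
      PivotalRelated F ((PivotalCover.map (Center.forget C)).obj X)
        ((PivotalCover.map (Center.forget D)).obj K) i := by
  obtain ⟨K, i, h⟩ := exists_centerRelated_of_center (F := F) X.obj
  let φ : X.obj.1 ≅ dual (dual X.obj.1) := ((PivotalCover.map (Center.forget C)).obj X).φ
  have hφ : X.φ.hom.f = φ.hom := (map_forget_obj_φ_hom X).symm
  let ψ : K.1 ≅ dual (dual K.1) :=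
    i.symm ≪≫ F.mapIso φ ≪≫ doubleDualityIso F X.obj.1 ≪≫ dualIso (dualIso i)
  have hψ : i.hom ≫ ψ.hom =
      F.map φ.hom ≫ (doubleDualityIso F X.obj.1).hom ≫ dualMap (dualMap i.hom) :=
    i.hom_inv_id_assoc _
  -- The transported `ψ` is so far a morphism of `D`; since `X^{**}` is related to `K^{**}`, it
  -- respects the half-braidings.
  obtain ⟨g, hg⟩ := h.comm_of_fac (K' := dual (dual K)) (h.doubleDual.comp_map X.φ.hom)
    (f := ψ.hom) (hψ.trans (by rw [hφ]; rfl))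
  have : IsIso g.f := hg ▸ (inferInstance : IsIso ψ.hom)
  have : IsIso g := Center.isIso_of_f_isIso g
  refine ⟨⟨K, asIso g⟩, i, h, ?_⟩
  refine hψ.symm.trans (congrArg (fun t => i.hom ≫ t) ?_)
  exact hg.symm.trans (map_forget_obj_φ_hom ⟨K, asIso g⟩).symm

theorem IsPivotalCofree.exists_of_equivalence {F : C ⥤ D} [F.Monoidal] [F.EssSurj] [F.Full]
    [F.Faithful] {X : PivotalCover (Center C)}
    {e : (PivotalCover.map (Center.forget C)).obj X ⟶ PivotalCover.unit C}
    (he : IsCofree X.obj (underlyingHom e)) :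
    ∃ (K : PivotalCover (Center D))
      (e' : (PivotalCover.map (Center.forget D)).obj K ⟶ PivotalCover.unit D)
      (i : F.obj X.obj.1 ≅ K.obj.1), IsPivotalCofree K e' ∧
        PivotalRelated F ((PivotalCover.map (Center.forget C)).obj X)
          ((PivotalCover.map (Center.forget D)).obj K) i := by
  obtain ⟨K, i, h, hi⟩ := exists_pivotal_centerRelated F X
  let e₀ : X.obj.1 ⟶ 𝟙_ C := underlyingHom e
  let φ : X.obj.1 ≅ dual (dual X.obj.1) := ((PivotalCover.map (Center.forget C)).obj X).φ
  let ψ : K.obj.1 ≅ dual (dual K.obj.1) := ((PivotalCover.map (Center.forget D)).obj K).φ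
  have h1 : F.map φ.hom ≫ (doubleDualityIso F X.obj.1).hom ≫ dualMap (dualMap i.hom) =
    i.hom ≫ ψ.hom := hi
  have h2 : e₀ ≫ unitDoubleDualIso.hom = φ.hom ≫ dualMap (dualMap e₀) := e.comm
  -- The transported counit; `h3` says that it is a morphism to the pivotal unit.
  let e₁ : K.obj.1 ⟶ 𝟙_ D := i.inv ≫ F.map e₀ ≫ η F
  have h3 : e₁ ≫ unitDoubleDualIso.hom = ψ.hom ≫ dualMap (dualMap e₁) := by
    have h4 : dualMap (dualMap i.hom) ≫ dualMap (dualMap i.inv) = 𝟙 _ := by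
      rw [← dualMap_comp, ← dualMap_comp, Iso.hom_inv_id, dualMap_id, dualMap_id]
    have h5 := congrArg F.map h2
    have h6 := doubleDualityIso_naturality F e₀
    rw [F.map_comp, F.map_comp] at h5
    rw [← cancel_epi i.hom, ← reassoc_of% h1]
    simp only [e₁, dualMap_comp, Category.assoc, Iso.hom_inv_id_assoc]
    rw [reassoc_of% h4, ← reassoc_of% h6, ← reassoc_of% h5, map_unitDoubleDualIso]
  obtain ⟨e', he'⟩ : ∃ e' : (PivotalCover.map (Center.forget D)).obj K ⟶ PivotalCover.unit D,
      underlyingHom e' = e₁ := ⟨⟨e₁, h3⟩, rfl⟩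
  refine ⟨K, e', i, IsCofree.isPivotalCofree ?_, hi⟩
  rw [he']
  exact h.isCofree he (Functor.Monoidal.εIso F).symm (i.hom_inv_id_assoc _)

theorem IsPivotalCofree.exists_iso {X Y : PivotalCover (Center C)} {V : PivotalCover C}
    {e : (PivotalCover.map (Center.forget C)).obj X ⟶ V}
    {e' : (PivotalCover.map (Center.forget C)).obj Y ⟶ V} (h : IsPivotalCofree X e)
    (h' : IsPivotalCofree Y e') : Nonempty (X ≅ Y) := by
  obtain ⟨a, ha, -⟩ := h' X e
  obtain ⟨b, hb, -⟩ := h Y e'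
  exact ⟨⟨a, b, (h X e).unique (by rw [Functor.map_comp, Category.assoc, hb, ha])
      (by rw [CategoryTheory.Functor.map_id, Category.id_comp]),
    (h' Y e').unique (by rw [Functor.map_comp, Category.assoc, ha, hb])
      (by rw [CategoryTheory.Functor.map_id, Category.id_comp])⟩⟩

theorem PivotalRelated.trans_iso {F : C ⥤ D} [F.Monoidal] {V : PivotalCover C}
    {W W' : PivotalCover D} {θ : F.obj V.obj ≅ W.obj} (h : PivotalRelated F V W θ) (j : W ≅ W') :
    ∃ θ' : F.obj V.obj ≅ W'.obj, PivotalRelated F V W' θ' := by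
  have h1 := j.hom.comm
  refine ⟨θ ≪≫ ⟨j.hom.f, j.inv.f, congrArg PivotalCover.Hom.f j.hom_inv_id,
    congrArg PivotalCover.Hom.f j.inv_hom_id⟩, ?_⟩
  have h2 : F.map V.φ.hom ≫ (doubleDualityIso F V.obj).hom ≫ dualMap (dualMap θ.hom) =
    θ.hom ≫ W.φ.hom := h
  change F.map V.φ.hom ≫ (doubleDualityIso F V.obj).hom ≫ dualMap (dualMap (θ.hom ≫ j.hom.f)) =
    (θ.hom ≫ j.hom.f) ≫ W'.φ.hom
  rw [dualMap_comp, dualMap_comp, reassoc_of% h2, Category.assoc, h1]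

end Invariance
end FSIndicator

theorem mainTheorem6 {k : Type*} [Field k]
    {C : Type*} [Category* C] [Abelian C] [Linear k C] [MonoidalCategory C]
    [MonoidalPreadditive C] [MonoidalLinear k C] [RigidCategory C]
    [FSIndicator.IsFiniteTensorCategory k C]
    {D : Type*} [Category* D] [Abelian D] [Linear k D] [MonoidalCategory D]
    [MonoidalPreadditive D] [MonoidalLinear k D] [RigidCategory D]
    [FSIndicator.IsFiniteTensorCategory k D]
    (F : C ⥤ D) [F.Monoidal] [F.IsEquivalence] [F.Additive] [F.Linear k] :
    (FSIndicator.PivotalCover.map (Center.forget C)).IsLeftAdjoint ∧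
    (FSIndicator.PivotalCover.map (Center.forget D)).IsLeftAdjoint ∧
    ∀ (IC : FSIndicator.PivotalCover C ⥤ FSIndicator.PivotalCover (Center C))
      (_ : FSIndicator.PivotalCover.map (Center.forget C) ⊣ IC)
      (ID : FSIndicator.PivotalCover D ⥤ FSIndicator.PivotalCover (Center D))
      (_ : FSIndicator.PivotalCover.map (Center.forget D) ⊣ ID) (n r : ℤ),
      FSIndicator.indicator k (FSIndicator.adjointObject IC) n r =
        FSIndicator.indicator k (FSIndicator.adjointObject ID) n r := by
  refine ⟨FSIndicator.isLeftAdjoint_map_forget k C, FSIndicator.isLeftAdjoint_map_forget k D, ?_⟩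
  intro IC adjC ID adjD n r
  have h1 := (FSIndicator.isPivotalCofree_of_adjunction adjC
    (FSIndicator.PivotalCover.unit C)).isCofree (FSIndicator.exists_isCofree k _)
  obtain ⟨K, e', i, h2, h3⟩ := FSIndicator.IsPivotalCofree.exists_of_equivalence (F := F) h1
  obtain ⟨j⟩ := h2.exists_iso
    (FSIndicator.isPivotalCofree_of_adjunction adjD (FSIndicator.PivotalCover.unit D))
  obtain ⟨θ, hθ⟩ := h3.trans_iso
    ((FSIndicator.PivotalCover.map (Center.forget D)).mapIso j)
  exact hθ.indicator_eq n r
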